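/- Let $P$ be a Markov kernel on a measurable space $(\mathsf X,\mathcal X)$ and $C\in\mathcal X$. Assume: (A1) there are $\epsilon\in(0,1]$ and a probability measure $\nu$ with $\nu(C)=1$ such that $P(x,A)\ge\epsilon\,\nu(A)$ for all $x\in C$, $A\in\mathcal X$; (A2) there are a concave, non-decreasing, differentiable function $\varphi:[1,\infty)\to\mathbb R^+$ with $\varphi(1)>0$, $\lim_{v\to\infty}\varphi(v)=\infty$, $\lim_{v\to\infty}\varphi'(v)=0$, a measurable $V:\mathsf X\to[1,\infty)$ and a constant $b>0$ such that $\sup_C V<\infty$ and $PV\le V-\varphi\circ V+b\mathbf 1_C$. Let $R$ be a finite bound: $V\le R$ on $C$. Notation. Put $Q(x,\cdot)=(1-\epsilon\mathbf 1_C(x))^{-1}\{P(x,\cdot)-\epsilon\mathbf 1_C(x)\nu\}$ if $\epsilon\mathbf 1_C(x)<1$ and $Q(x,\cdot)=\delta_x$ otherwise. For a probability measure $\mu$ on $\mathsf X$ let $\check\mu$ be the probability measure on $\mathsf X\times\{0,1\}$ with $\check\mu(A\times\{0\})=\int_A(1-\epsilon\mathbf 1_C)\,d\mu$ and $\check\mu(A\times\{1\})=\epsilon\,\mu(A\cap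 C)$. The split chain $(X_n,d_n)_{n\ge0}$ is the Markov chain on $\mathsf X\times\{0,1\}$ whose transition law from $(x,0)$ is the split measure of $Q(x,\cdot)$ and from $(x,1)$ is the split measure of $\nu$; $\check{\mathbb P}_{\check\mu},\check{\mathbb E}_{\check\mu}$ refer to this chain with initial law $\check\mu$, and $\check\sigma=\inf\{k\ge0: d_k=1\}$ (sums up to $\check\sigma$ are sums over all $k\ge 0$ if $\check\sigma=\infty$). Let $\Phi(v)=\int_1^v dx/\varphi(x)$ for $v\ge1$, let $\Phi^{-1}:[0,\infty)\to[1,\infty)$ be its inverse, and $r_\varphi(u)=\varphi(\Phi^{-1}(u))/\varphi(\Phi^{-1}(0))$ for $u\ge 0$. Let $\mathcal G(\varphi)$ be the set of functions $\psi:[1,\infty)\to\mathbb R$ such that $\psi$ is non-decreasing and $\psi/\varphi$ is non-increasing (such $\psi$ are non-negative), and $H_\psi(v)=\int_1^v\frac{\psi(u)}{\varphi(u)}\,du$. Then: (i) For every $\psi\in\mathcal G(\varphi)$ there is a finite constant $B_\psi$, depending only on $\psi,\varphi,\epsilon,b,R$, such that for all $x\in\mathsf X$ $$\check{\mathbb E}_{\check\delta_x}\Big[\sum_{k=0}^{\check\sigma}\psi(V(X_k))\Big]\le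 H_\psi(V(x))\,\mathbf 1_{C^c}(x)+B_\psi .$$ (ii) For every $\delta>0$ there is a finite constant $B_\varphi$, depending only on $\delta,\varphi,\epsilon,b,R$, such that for all $x\in\mathsf X$ $$\check{\mathbb E}_{\check\delta_x}\Big[\sum_{k=0}^{\check\sigma}r_\varphi(k)\Big]\le(1+\delta)\,\frac{V(x)}{\varphi(1)}\,\mathbf 1_{C^c}(x)+B_\varphi .$$ (iii) For every $a\in\mathbb R$ there is a finite constant $\kappa$, depending only on $a,\varphi,\epsilon,b,R$, such that for all $c\in(0,1)$, $K\ge1$, $M>0$, all $\psi\in\mathcal G(\varphi)$ with $\psi(1)\le a$, and all $x\in\mathsf X$ $$\check{\mathbb P}_{\check\delta_x}\Big(\sum_{k=0}^{\check\sigma}\psi(V(X_k))\ge M\Big)\le\kappa\left[\frac{1}{\Phi^{-1}\{cM/\psi(K)\}}+\frac{H_\psi(K)+1}{(1-c)MK}\right]V(x),$$ where $cM/\psi(K)$ is read as $0$ if $\psi(K)=0$ (then $\psi\equiv0$ and the left-hand side is $0$). -/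

import Mathlib

open MeasureTheory ProbabilityTheory Set Filter Topology
open scoped ENNReal

universe u

noncomputable section

namespace SubgeometricRegeneration

/-- The one-step minorization condition: `C` is a measurable set, `ε ∈ (0,1]`, `ν` is a probability
measure with `ν C = 1`, and `P x A ≥ ε ν A` for all `x ∈ C` and all measurable `A`. -/
structure SmallSet {X : Type*} [MeasurableSpace X] (P : Kernel X X) (C : Set X) (ε : ℝ)
    (ν : Measure X) : Prop where
  measurableSet : MeasurableSet C
  eps_pos : 0 < ε
  eps_le_one : ε ≤ 1
  isProbabilityMeasure : IsProbabilityMeasure ν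
  concentrated : ν C = 1
  minorization : ∀ x ∈ C, ∀ A, MeasurableSet A → ENNReal.ofReal ε * ν A ≤ P x A

/-- The properties of the function `φ : [1,∞) → ℝ⁺` in the drift condition (only the values of `φ`
on `[1,∞)` matter). -/
structure IsDriftRate (φ : ℝ → ℝ) : Prop where
  concave : ConcaveOn ℝ (Ici 1) φ
  monotone : MonotoneOn φ (Ici 1)
  differentiable : DifferentiableOn ℝ φ (Ici 1)
  pos : 0 < φ 1
  tendsto_atTop : Tendsto φ atTop atTop
  tendsto_deriv : Tendsto (deriv φ) atTop (𝓝 0)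

/-- The drift inequality `P V ≤ V - φ ∘ V + b 1_C` for a measurable `V : X → [1,∞)` which is bounded
by the constant `R` on `C`. -/
structure DriftCondition {X : Type*} [MeasurableSpace X] (P : Kernel X X) (C : Set X)
    (φ : ℝ → ℝ) (V : X → ℝ) (b R : ℝ) : Prop where
  measurable : Measurable V
  one_le : ∀ x, 1 ≤ V x
  le_on : ∀ x ∈ C, V x ≤ R
  drift : ∀ x, ∫⁻ y, ENNReal.ofReal (V y) ∂(P x) ≤
    ENNReal.ofReal (V x - φ (V x) + b * C.indicator 1 x)

/-- `Φ(v) = ∫₁^v dx / φ(x)`. -/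
def Phi (φ : ℝ → ℝ) (v : ℝ) : ℝ := ∫ x in (1 : ℝ)..v, 1 / φ x

/-- The inverse `[0,∞) → [1,∞)` of `Φ : [1,∞) → [0,∞)`. -/
def PhiInv (φ : ℝ → ℝ) : ℝ → ℝ := Function.invFunOn (Phi φ) (Ici 1)

/-- `r_φ(u) = φ(Φ⁻¹(u)) / φ(Φ⁻¹(0))`. -/
def rate (φ : ℝ → ℝ) (u : ℝ) : ℝ := φ (PhiInv φ u) / φ (PhiInv φ 0)

/-- The class `𝒢(φ)` of functions `ψ` on `[1,∞)` such that `ψ` is non-decreasing and `ψ / φ` is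
non-increasing. -/
def G (φ : ℝ → ℝ) : Set (ℝ → ℝ) :=
  {ψ | MonotoneOn ψ (Ici 1) ∧ AntitoneOn (fun v => ψ v / φ v) (Ici 1)}

/-- `Φ[ψ](v) = ∫₁^v ψ(u) / φ(u) du`. -/
def PhiOf (φ ψ : ℝ → ℝ) (v : ℝ) : ℝ := ∫ u in (1 : ℝ)..v, ψ u / φ u

section Split

variable {X : Type*} [MeasurableSpace X]

open Classical in
/-- The measure `Q(x, ·) = (1 - ε 1_C(x))⁻¹ (P(x, ·) - ε 1_C(x) ν)` if `ε 1_C(x) < 1`, and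
`Q(x, ·) = δ_x` if `ε 1_C(x) = 1`. -/
def residualMeasure (P : Kernel X X) (C : Set X) (ε : ℝ) (ν : Measure X) (x : X) : Measure X :=
  if ε * C.indicator 1 x = 1 then Measure.dirac x
  else (ENNReal.ofReal (1 - ε * C.indicator 1 x))⁻¹ •
    (P x - ENNReal.ofReal (ε * C.indicator 1 x) • ν)

variable {P : Kernel X X} {C : Set X} {ε : ℝ} {ν : Measure X}

lemma SmallSet.smul_le (h : SmallSet P C ε ν) (x : X) :
    ENNReal.ofReal (ε * C.indicator 1 x) • ν ≤ P x := by
  refine Measure.le_iff.2 fun A hA => ?_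
  by_cases hx : x ∈ C
  · simpa [hx] using h.minorization x hx A hA
  · simp [hx]

lemma SmallSet.weight_le_one (h : SmallSet P C ε ν) (x : X) : ε * C.indicator 1 x ≤ 1 := by
  by_cases hx : x ∈ C
  · simpa [hx] using h.eps_le_one
  · simp [hx]

lemma SmallSet.weight_nonneg (h : SmallSet P C ε ν) (x : X) : 0 ≤ ε * C.indicator 1 x := by
  by_cases hx : x ∈ C
  · simpa [hx] using h.eps_pos.le
  · simp [hx]

lemma SmallSet.measurable_weight (h : SmallSet P C ε ν) :
    Measurable fun x => ε * C.indicator (1 : X → ℝ) x :=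
  (measurable_one.indicator h.measurableSet).const_mul ε

lemma SmallSet.measurable_residualMeasure (h : SmallSet P C ε ν) :
    Measurable (residualMeasure P C ε ν) := by
  have := h.isProbabilityMeasure
  have hm := h.measurable_weight
  refine Measurable.ite (hm (measurableSet_singleton 1)) Measure.measurable_dirac ?_
  refine Measure.measurable_of_measurable_coe _ fun A hA => ?_
  have hfin : ∀ x, IsFiniteMeasure (ENNReal.ofReal (ε * C.indicator 1 x) • ν) := fun x =>
    ν.smul_finite ENNReal.ofReal_ne_top
  have he : (fun x => ((ENNReal.ofReal (1 - ε * C.indicator 1 x))⁻¹ •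
      (P x - ENNReal.ofReal (ε * C.indicator 1 x) • ν)) A) = fun x =>
      (ENNReal.ofReal (1 - ε * C.indicator 1 x))⁻¹ *
        (P x A - ENNReal.ofReal (ε * C.indicator 1 x) * ν A) := by
    funext x
    have := hfin x
    rw [Measure.smul_apply, Measure.sub_apply hA (h.smul_le x), Measure.smul_apply,
      smul_eq_mul, smul_eq_mul]
  rw [he]
  exact (hm.const_sub 1).ennreal_ofReal.inv.mul
    ((P.measurable_coe hA).sub (hm.ennreal_ofReal.mul_const _))

/-- The residual kernel `Q`. -/
def residualKernel (h : SmallSet P C ε ν) : Kernel X X where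
  toFun := residualMeasure P C ε ν
  measurable' := h.measurable_residualMeasure

instance [IsMarkovKernel P] (h : SmallSet P C ε ν) : IsMarkovKernel (residualKernel h) := by
  have := h.isProbabilityMeasure
  refine ⟨fun x => ⟨?_⟩⟩
  change residualMeasure P C ε ν x univ = 1
  unfold residualMeasure
  split_ifs with hx
  · simp
  · have : IsFiniteMeasure (ENNReal.ofReal (ε * C.indicator 1 x) • ν) :=
      ν.smul_finite ENNReal.ofReal_ne_top
    have hlt : ε * C.indicator 1 x < 1 := lt_of_le_of_ne (h.weight_le_one x) hx
    rw [Measure.smul_apply, Measure.sub_apply .univ (h.smul_le x), Measure.smul_apply,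
      smul_eq_mul, smul_eq_mul, measure_univ, measure_univ, mul_one,
      ← ENNReal.ofReal_one, ← ENNReal.ofReal_sub _ (h.weight_nonneg x)]
    simpa only [ENNReal.ofReal_one] using ENNReal.inv_mul_cancel (ENNReal.ofReal_pos.2 (sub_pos.2 hlt)).ne' ENNReal.ofReal_ne_top

/-- The split measure `μ̌` on `X × {0,1}` (with `0 = false`, `1 = true`):
`μ̌(A × {0}) = ∫_A (1 - ε 1_C) dμ` and `μ̌(A × {1}) = ε μ(A ∩ C)`. -/
def splitMeasure (C : Set X) (ε : ℝ) (μ : Measure X) : Measure (X × Bool) :=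
  (μ.withDensity fun y => ENNReal.ofReal (1 - ε * C.indicator 1 y)).map (fun y => (y, false)) +
    (ENNReal.ofReal ε • μ.restrict C).map (fun y => (y, true))

lemma splitMeasure_apply (C : Set X) (ε : ℝ) (μ : Measure X) {S : Set (X × Bool)}
    (hS : MeasurableSet S) :
    splitMeasure C ε μ S =
      ∫⁻ y in (fun y => (y, false)) ⁻¹' S, ENNReal.ofReal (1 - ε * C.indicator 1 y) ∂μ +
        ENNReal.ofReal ε * μ ((fun y => (y, true)) ⁻¹' S ∩ C) := by
  have h0 : Measurable (fun y : X => (y, false)) := by fun_prop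
  have h1 : Measurable (fun y : X => (y, true)) := by fun_prop
  rw [splitMeasure, Measure.add_apply, Measure.map_apply h0 hS, Measure.map_apply h1 hS,
    withDensity_apply _ (h0 hS), Measure.smul_apply, Measure.restrict_apply (h1 hS), smul_eq_mul]

lemma SmallSet.isProbabilityMeasure_splitMeasure (h : SmallSet P C ε ν) (μ : Measure X)
    [IsProbabilityMeasure μ] : IsProbabilityMeasure (splitMeasure C ε μ) := by
  refine ⟨?_⟩
  rw [splitMeasure_apply _ _ _ .univ, preimage_univ, preimage_univ, univ_inter,
    Measure.restrict_univ]
  have h1 : ENNReal.ofReal ε * μ C = ∫⁻ y, ENNReal.ofReal (ε * C.indicator 1 y) ∂μ := by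
    have : (fun y => ENNReal.ofReal (ε * C.indicator 1 y)) =
        C.indicator fun _ => ENNReal.ofReal ε := by
      funext y
      by_cases hy : y ∈ C <;> simp [hy]
    rw [this, lintegral_indicator_const h.measurableSet]
  rw [h1, ← lintegral_add_right _ h.measurable_weight.ennreal_ofReal]
  have h2 : ∀ y, ENNReal.ofReal (1 - ε * C.indicator 1 y) +
      ENNReal.ofReal (ε * C.indicator 1 y) = 1 := fun y => by
    rw [← ENNReal.ofReal_add (sub_nonneg.2 (h.weight_le_one y)) (h.weight_nonneg y)]
    simp
  simp [h2]

lemma SmallSet.measurable_splitMeasure (h : SmallSet P C ε ν) :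
    Measurable (splitMeasure C ε : Measure X → Measure (X × Bool)) := by
  refine Measure.measurable_of_measurable_coe _ fun S hS => ?_
  simp_rw [splitMeasure_apply C ε _ hS]
  have h0 : Measurable (fun y : X => (y, false)) := by fun_prop
  have h1 : Measurable (fun y : X => (y, true)) := by fun_prop
  refine Measurable.add ?_
    ((Measure.measurable_coe ((h1 hS).inter h.measurableSet)).const_mul _)
  simp_rw [← lintegral_indicator (h0 hS)]
  exact Measure.measurable_lintegral
    ((h.measurable_weight.const_sub 1).ennreal_ofReal.indicator (h0 hS))

/-- The split kernel `P̌` on `X × {0,1}`: `P̌(x,0; ·)` is the split measure of `Q(x, ·)` and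
`P̌(x,1; ·)` is the split measure of `ν`. -/
def splitKernel (h : SmallSet P C ε ν) : Kernel (X × Bool) (X × Bool) where
  toFun z := splitMeasure C ε (if z.2 = true then ν else residualKernel h z.1)
  measurable' := h.measurable_splitMeasure.comp <|
    Measurable.ite (measurable_snd (measurableSet_singleton true)) measurable_const
      ((residualKernel h).measurable.comp measurable_fst)

instance [IsMarkovKernel P] (h : SmallSet P C ε ν) : IsMarkovKernel (splitKernel h) := by
  have := h.isProbabilityMeasure
  refine ⟨fun z => ?_⟩
  change IsProbabilityMeasure (splitMeasure C ε (if z.2 = true then ν else residualKernel h z.1))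
  split_ifs
  · exact h.isProbabilityMeasure_splitMeasure ν
  · exact h.isProbabilityMeasure_splitMeasure _

/-- The law `ℙ̌_{μ̌}` on trajectories `(X_n, d_n)_{n ≥ 0}` of the Markov chain with initial
distribution `μ̌` and transition kernel `P̌`. -/
def splitChain [IsMarkovKernel P] (h : SmallSet P C ε ν) (μ : Measure X) :
    Measure (ℕ → X × Bool) :=
  Kernel.trajMeasure (X := fun _ => X × Bool) (splitMeasure C ε μ) fun n =>
    (splitKernel h).comap (fun w : (i : Finset.Iic n) → X × Bool => w ⟨n, by simp⟩)
      (measurable_pi_apply _)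

/-- The regeneration time `σ̌ = inf {k ≥ 0 : d_k = 1}` (`⊤` if there is no such `k`). -/
def regenTime (ω : ℕ → X × Bool) : WithTop ℕ :=
  hittingAfter (fun n (w : ℕ → X × Bool) => w n) {z | z.2 = true} 0 ω

/-- `∑_{k=0}^{σ̌} g_k`, with values in `[0,∞]`; the sum is over all `k ≥ 0` if `σ̌ = ∞`. -/
def excursionSum (g : ℕ → (ℕ → X × Bool) → ℝ) (ω : ℕ → X × Bool) : ℝ≥0∞ :=
  ∑' k : ℕ, {k : ℕ | (k : WithTop ℕ) ≤ regenTime ω}.indicator (fun k => ENNReal.ofReal (g k ω)) k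

end Split

end SubgeometricRegeneration

end

open SubgeometricRegeneration

/-! The chain is killed at its first regeneration. Since `d_k = 1` has conditional probability `ε
1_C(X_k)` given `X_k` and the past, the killed chain moves by `(1 - ε 1_C) Q = P - ε 1_C ν ≤ P`.
Hence an expected sum up to regeneration is at most `W_0(x)` as soon as `g_n + (1 - ε 1_C) Q W_{n+1}
≤ W_n` (`tsum_survivalExp_le`). The supersolutions have the form `W_n = w_n 1_{C^c} + B_n`: off `C`
the drift of `w_n` pays for `g_n`, while on `C` the killing gains `ε B_{n+1}`, which absorbs the
bounded errors (`lintegral_excursionSum_le`). The drift of `V` passes to concave increasing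
functions of `V` through their tangents (`DriftCondition.lintegral_le`).

For (i), `w = H_ψ ∘ V` is such a function because `ψ / φ` is non-increasing, and `B` is constant.

For (ii), `w_n` is `(1 + δ) / φ(1)` times the difference at time `n` between the solutions of `ẇ =
φ(w)` started from `V` and from `1`. The solution is concave in its initial value (`flow_sub_le`),
and the subtracted one produces the drift `-(1 + δ) r_φ(n)`. The surplus `δ r_φ(n)` lets `B_n` grow
like `δ ∑_{k<n} r_φ(k)`. This growth suffices on `C` because `φ' → 0` makes `r_φ` subgeometric:
`r_φ(n+1)` is at most any small multiple of the preceding sum plus a constant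
(`exists_rate_le_sum`).

For (iii), the sum is split according to `V ≤ K` or `V > K`. If the first part reaches `cM`, then
`σ̌ + 1 ≥ cM / ψ(K)`, which forces a large sum of `r_φ` (`exists_PhiInv_le_excursionSum_rate`);
Markov's inequality and (ii) apply. The second part is treated by Markov's inequality and the
argument of (i) (`lintegral_excursionSum_gt_le`), with `ψ(K) / φ(K)` controlled by `ratio_le`. -/

noncomputable section

namespace SubgeometricRegeneration

/-! ### The chain killed at regeneration and the comparison principle. -/

section Chain

/-- The trajectories with no regeneration strictly before time `k`. -/
def noRegen {X : Type*} (k : ℕ) : Set (ℕ → X × Bool) := {ω | ∀ j < k, (ω j).2 = false}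

lemma noRegen_succ {X : Type*} (k : ℕ) :
    (noRegen (k + 1) : Set (ℕ → X × Bool)) = noRegen k ∩ {ω | (ω k).2 = false} := by
  ext ω
  simp only [noRegen, mem_ofPred_eq, mem_inter_iff, Nat.lt_succ_iff_lt_or_eq]
  exact ⟨fun h => ⟨fun j hj => h j (.inl hj), h k (.inr rfl)⟩,
    fun h j hj => hj.elim (h.1 j) fun e => e ▸ h.2⟩


lemma le_regenTime_iff {X : Type*} (ω : ℕ → X × Bool) (k : ℕ) :
    (k : WithTop ℕ) ≤ regenTime ω ↔ ω ∈ noRegen k := by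
  unfold regenTime hittingAfter noRegen
  simp only [mem_ofPred_eq]
  split_ifs with hex
  · refine (WithTop.coe_le_coe (b := k)).trans ?_
    constructor
    · intro hk j hj
      by_contra hne
      have : sInf {i : ℕ | 0 ≤ i ∧ (ω i).2 = true} ≤ j := Nat.sInf_le ⟨zero_le, by simpa using hne⟩
      omega
    · intro hk
      have hmem : sInf {i : ℕ | 0 ≤ i ∧ (ω i).2 = true} ∈ {i : ℕ | 0 ≤ i ∧ (ω i).2 = true} :=
        Nat.sInf_mem hex
      by_contra hlt
      have := hk _ (not_le.1 hlt)
      simp only [mem_ofPred_eq] at hmem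
      rw [this] at hmem
      simp at hmem
  · simp only [le_top, true_iff]
    intro j _
    by_contra hne
    exact hex ⟨j, zero_le, by simpa using hne⟩

lemma excursionSum_eq_tsum {X : Type*} (g : ℕ → (ℕ → X × Bool) → ℝ) (ω : ℕ → X × Bool) :
    excursionSum g ω = ∑' k, (noRegen k).indicator (fun ω => ENNReal.ofReal (g k ω)) ω := by
  unfold excursionSum
  congr 1
  funext k
  by_cases hk : ω ∈ noRegen k
  · rw [indicator_of_mem hk, indicator_of_mem (by simpa [le_regenTime_iff] using hk)]
  · rw [indicator_of_notMem hk, indicator_of_notMem (by simpa [le_regenTime_iff] using hk)]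

variable {X : Type*} [MeasurableSpace X] {P : Kernel X X} {C : Set X} {ε : ℝ} {ν : Measure X}

lemma measurableSet_noRegen (k : ℕ) : MeasurableSet (noRegen k : Set (ℕ → X × Bool)) := by
  have : (noRegen k : Set (ℕ → X × Bool)) = ⋂ j, ⋂ (_ : j < k), (fun ω => (ω j).2) ⁻¹' {false} := by
    ext ω; simp [noRegen]
  rw [this]
  refine MeasurableSet.iInter fun j => MeasurableSet.iInter fun _ => ?_
  exact (measurable_snd.comp (measurable_pi_apply j)) (measurableSet_singleton _)

lemma lintegral_splitMeasure (h : SmallSet P C ε ν) (μ : Measure X) {G : X × Bool → ℝ≥0∞}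
    (hG : Measurable G) :
    ∫⁻ z, G z ∂(splitMeasure C ε μ) =
      ∫⁻ y, (ENNReal.ofReal (1 - ε * C.indicator 1 y) * G (y, false) +
        ENNReal.ofReal (ε * C.indicator 1 y) * G (y, true)) ∂μ := by
  have h0 : Measurable (fun y : X => (y, false)) := by fun_prop
  have h1 : Measurable (fun y : X => (y, true)) := by fun_prop
  have hm := (h.measurable_weight.const_sub 1).ennreal_ofReal
  have hG0 : Measurable fun y => G (y, false) := hG.comp h0
  have hG1 : Measurable fun y => G (y, true) := hG.comp h1
  rw [splitMeasure, lintegral_add_measure, lintegral_map hG h0, lintegral_map hG h1,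
    lintegral_withDensity_eq_lintegral_mul _ hm hG0, lintegral_smul_measure,
    lintegral_add_left (f := fun y => ENNReal.ofReal (1 - ε * C.indicator 1 y) * G (y, false))
      (hm.mul hG0)]
  congr 1
  rw [smul_eq_mul, ← lintegral_const_mul _ hG1, ← lintegral_indicator h.measurableSet]
  refine lintegral_congr fun y => ?_
  by_cases hy : y ∈ C <;> simp [hy]

lemma lintegral_splitMeasure_fst (h : SmallSet P C ε ν) (μ : Measure X) {f : X → ℝ≥0∞}
    (hf : Measurable f) : ∫⁻ z, f z.1 ∂(splitMeasure C ε μ) = ∫⁻ y, f y ∂μ := by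
  rw [lintegral_splitMeasure h μ (G := fun z => f z.1) (hf.comp measurable_fst)]
  refine lintegral_congr fun y => ?_
  simp only
  rw [← add_mul, ← ENNReal.ofReal_add (sub_nonneg.2 (h.weight_le_one y)) (h.weight_nonneg y)]
  simp

/-- The weight `1 - ε 1_C` of the non-regenerating copy of the state space. -/
def keepWeight (C : Set X) (ε : ℝ) (y : X) : ℝ≥0∞ := ENNReal.ofReal (1 - ε * C.indicator 1 y)

lemma measurable_keepWeight (h : SmallSet P C ε ν) : Measurable (keepWeight C ε) :=
  (h.measurable_weight.const_sub 1).ennreal_ofReal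

lemma lintegral_splitMeasure_false (h : SmallSet P C ε ν) (μ : Measure X) {f : X → ℝ≥0∞}
    (hf : Measurable f) :
    ∫⁻ z, {z : X × Bool | z.2 = false}.indicator (fun z => f z.1) z ∂(splitMeasure C ε μ) =
      ∫⁻ z, keepWeight C ε z.1 * f z.1 ∂(splitMeasure C ε μ) := by
  rw [lintegral_splitMeasure_fst (f := fun y => keepWeight C ε y * f y) h μ
      ((measurable_keepWeight h).mul hf),
    lintegral_splitMeasure h μ
      (G := {z : X × Bool | z.2 = false}.indicator fun z => f z.1) ((hf.comp measurable_fst).indicator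
      (measurable_snd (measurableSet_singleton false)))]
  refine lintegral_congr fun y => ?_
  simp [indicator, keepWeight]

/-- The weight cancels the normalisation of `Q`, leaving `P - ε 1_C ν`. When `ε 1_C(x) = 1` it
vanishes, so the convention `Q(x, ·) = δ_x` plays no role. -/
lemma keepWeight_mul_lintegral_residual_le (h : SmallSet P C ε ν) (x : X) (f : X → ℝ≥0∞) :
    keepWeight C ε x * ∫⁻ y, f y ∂(residualKernel h x) ≤ ∫⁻ y, f y ∂(P x) := by
  by_cases hx : ε * C.indicator 1 x = 1
  · simp [keepWeight, hx]
  · have hlt : ε * C.indicator 1 x < 1 := lt_of_le_of_ne (h.weight_le_one x) hx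
    have he : residualKernel h x = (ENNReal.ofReal (1 - ε * C.indicator 1 x))⁻¹ •
        (P x - ENNReal.ofReal (ε * C.indicator 1 x) • ν) := by
      change residualMeasure P C ε ν x = _
      rw [residualMeasure, if_neg hx]
    rw [he, lintegral_smul_measure, smul_eq_mul, ← mul_assoc, keepWeight,
      ENNReal.mul_inv_cancel (ENNReal.ofReal_pos.2 (sub_pos.2 hlt)).ne' ENNReal.ofReal_ne_top,
      one_mul]
    exact lintegral_mono' Measure.sub_le le_rfl

variable [IsMarkovKernel P]

lemma map_splitChain_zero (h : SmallSet P C ε ν) (μ : Measure X) [IsProbabilityMeasure μ] :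
    (splitChain h μ).map (fun ω => ω 0) = splitMeasure C ε μ := by
  have := h.isProbabilityMeasure_splitMeasure μ
  unfold splitChain Kernel.trajMeasure
  have hc : (fun ω : ℕ → X × Bool => ω 0) =
      (MeasurableEquiv.piUnique (fun _ : Finset.Iic 0 => X × Bool)) ∘
        (Preorder.frestrictLe (π := fun _ => X × Bool) 0) := rfl
  rw [hc, ← Measure.map_map (by fun_prop) (by fun_prop), Measure.map_comp _ _ (by fun_prop),
    Kernel.traj_map_frestrictLe, Kernel.partialTraj_self, Measure.id_comp,
    Measure.map_map (by fun_prop) (by fun_prop)]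
  exact Measure.map_id

/-- The Markov property at time `n`, for a product of a function of the past and a function of the
next state. -/
lemma lintegral_splitChain_succ (h : SmallSet P C ε ν) (μ : Measure X) [IsProbabilityMeasure μ]
    (n : ℕ) {F : ((i : Finset.Iic n) → X × Bool) → ℝ≥0∞} (hF : Measurable F)
    {G : X × Bool → ℝ≥0∞} (hG : Measurable G) :
    ∫⁻ ω, F (Preorder.frestrictLe n ω) * G (ω (n + 1)) ∂(splitChain h μ) =
      ∫⁻ ω, F (Preorder.frestrictLe n ω) * ∫⁻ z, G z ∂(splitKernel h (ω n)) ∂(splitChain h μ) := by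
  have := h.isProbabilityMeasure_splitMeasure μ
  let κ : (n : ℕ) → Kernel ((i : Finset.Iic n) → X × Bool) (X × Bool) := fun n =>
      (splitKernel h).comap (fun w : (i : Finset.Iic n) → X × Bool => w ⟨n, by simp⟩)
        (measurable_pi_apply _)
  have key := Kernel.map_frestrictLe_trajMeasure_compProd_eq_map_trajMeasure
    (X := fun _ => X × Bool) (μ₀ := splitMeasure C ε μ) (κ := κ) (a := n)
  have hFG : Measurable fun p : ((i : Finset.Iic n) → X × Bool) × (X × Bool) => F p.1 * G p.2 := by
    fun_prop
  have hl := congrArg (fun m => ∫⁻ p, F p.1 * G p.2 ∂m) key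
  rw [lintegral_map hFG (by fun_prop), Measure.lintegral_compProd hFG] at hl
  change _ = ∫⁻ ω, F (Preorder.frestrictLe n ω) * G (ω (n + 1)) ∂(splitChain h μ) at hl
  rw [← hl, lintegral_map _ (by fun_prop)]
  · refine lintegral_congr fun ω => ?_
    exact lintegral_const_mul (μ := splitKernel h (ω n)) (F (Preorder.frestrictLe n ω)) hG
  · exact Measurable.lintegral_kernel_prod_right' hFG

/-- `𝔼[1{d_0 = ⋯ = d_{k-1} = 0} G(X_k, d_k)]`. -/
def survivalExp (h : SmallSet P C ε ν) (μ : Measure X) (k : ℕ) (G : X × Bool → ℝ≥0∞) : ℝ≥0∞ :=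
  ∫⁻ ω, (noRegen k).indicator (fun ω => G (ω k)) ω ∂(splitChain h μ)

lemma survivalExp_mono (h : SmallSet P C ε ν) (μ : Measure X) (k : ℕ) {G G' : X × Bool → ℝ≥0∞}
    (hG : ∀ z, G z ≤ G' z) : survivalExp h μ k G ≤ survivalExp h μ k G' :=
  lintegral_mono fun ω => by gcongr; exact hG _

lemma survivalExp_add (h : SmallSet P C ε ν) (μ : Measure X) (k : ℕ) {G G' : X × Bool → ℝ≥0∞}
    (hG : Measurable G) :
    survivalExp h μ k (fun z => G z + G' z) = survivalExp h μ k G + survivalExp h μ k G' := by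
  unfold survivalExp
  rw [← lintegral_add_left (f := (noRegen k).indicator fun ω => G (ω k))
    ((hG.comp (measurable_pi_apply k)).indicator (measurableSet_noRegen k))]
  refine lintegral_congr fun ω => ?_
  by_cases hω : ω ∈ noRegen k <;> simp [hω]

lemma survivalExp_zero (h : SmallSet P C ε ν) (μ : Measure X) [IsProbabilityMeasure μ]
    {G : X × Bool → ℝ≥0∞} (hG : Measurable G) :
    survivalExp h μ 0 G = ∫⁻ z, G z ∂(splitMeasure C ε μ) := by
  rw [← map_splitChain_zero h μ, lintegral_map hG (measurable_pi_apply 0)]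
  refine lintegral_congr fun ω => ?_
  simp [noRegen]

lemma survivalExp_succ (h : SmallSet P C ε ν) (μ : Measure X) [IsProbabilityMeasure μ] (k : ℕ)
    {G : X × Bool → ℝ≥0∞} (hG : Measurable G) :
    survivalExp h μ (k + 1) G = survivalExp h μ k
      ({z : X × Bool | z.2 = false}.indicator fun z => ∫⁻ z', G z' ∂(splitKernel h z)) := by
  -- Survival up to time `k + 1` only involves the flags at times `0, …, k`, hence is an event of
  -- the past at time `k`.
  let S : Set ((i : Finset.Iic k) → X × Bool) := {w | ∀ i, (w i).2 = false}
  have hS : MeasurableSet S := by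
    have : S = ⋂ i, (fun w => (w i).2) ⁻¹' {false} := by ext w; simp [S]
    rw [this]
    exact MeasurableSet.iInter fun i =>
      (measurable_snd.comp (measurable_pi_apply i)) (measurableSet_singleton _)
  have hmem : ∀ ω : ℕ → X × Bool, Preorder.frestrictLe k ω ∈ S ↔ ω ∈ noRegen (k + 1) := by
    intro ω
    constructor
    · intro hw j hj
      exact hw ⟨j, by simpa [Nat.lt_succ_iff] using hj⟩
    · rintro hw ⟨i, hi⟩
      exact hw i (by simpa [Nat.lt_succ_iff] using hi)
  have key := lintegral_splitChain_succ h μ k (F := S.indicator 1) (measurable_one.indicator hS) hG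
  unfold survivalExp
  convert key using 1
  · refine lintegral_congr fun ω => ?_
    by_cases hω : ω ∈ noRegen (k + 1)
    · simp [hω, (hmem ω).2 hω]
    · simp [hω, mt (hmem ω).1 hω]
  · refine lintegral_congr fun ω => ?_
    by_cases hω : ω ∈ noRegen (k + 1)
    · have h2 := hω
      rw [noRegen_succ] at h2
      rw [indicator_of_mem h2.1, indicator_of_mem (by exact h2.2),
        indicator_of_mem ((hmem ω).2 hω)]
      simp
    · rw [indicator_of_notMem (mt (hmem ω).1 hω), zero_mul]
      rw [noRegen_succ] at hω
      by_cases h1 : ω ∈ noRegen k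
      · rw [indicator_of_mem h1, indicator_of_notMem (s := {z : X × Bool | z.2 = false})
          fun h3 => hω ⟨h1, h3⟩]
      · rw [indicator_of_notMem h1]

/-- Both the initial law and every one-step law are split measures, so at each time the flag can be
averaged out given the position. This reduces the recursion to functions on `X` alone. -/
lemma survivalExp_false (h : SmallSet P C ε ν) (μ : Measure X) [IsProbabilityMeasure μ] (k : ℕ)
    {f : X → ℝ≥0∞} (hf : Measurable f) :
    survivalExp h μ k ({z : X × Bool | z.2 = false}.indicator fun z => f z.1) =
      survivalExp h μ k fun z => keepWeight C ε z.1 * f z.1 := by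
  have hm1 : Measurable ({z : X × Bool | z.2 = false}.indicator fun z => f z.1) :=
    (hf.comp measurable_fst).indicator (measurable_snd (measurableSet_singleton false))
  have hm2 : Measurable fun z : X × Bool => keepWeight C ε z.1 * f z.1 :=
    ((measurable_keepWeight h).mul hf).comp measurable_fst
  cases k with
  | zero => rw [survivalExp_zero h μ hm1, survivalExp_zero h μ hm2,
      lintegral_splitMeasure_false h μ hf]
  | succ k =>
    rw [survivalExp_succ h μ k hm1, survivalExp_succ h μ k hm2]
    congr 2
    funext z
    exact lintegral_splitMeasure_false h _ hf

lemma survivalExp_succ_fst (h : SmallSet P C ε ν) (μ : Measure X) [IsProbabilityMeasure μ] (k : ℕ)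
    {f : X → ℝ≥0∞} (hf : Measurable f) :
    survivalExp h μ (k + 1) (fun z => f z.1) =
      survivalExp h μ k fun z => keepWeight C ε z.1 * ∫⁻ y, f y ∂(residualKernel h z.1) := by
  rw [survivalExp_succ h μ k (G := fun z => f z.1) (hf.comp measurable_fst),
    ← survivalExp_false h μ k (f := fun x => ∫⁻ y, f y ∂(residualKernel h x))
      hf.lintegral_kernel]
  congr 1
  funext z
  by_cases hz : z.2 = false
  · rw [indicator_of_mem (by exact hz), indicator_of_mem (by exact hz)]
    change ∫⁻ z', f z'.1 ∂(splitMeasure C ε (if z.2 = true then ν else residualKernel h z.1)) = _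
    rw [lintegral_splitMeasure_fst h _ hf, if_neg (by simp [hz])]
  · rw [indicator_of_notMem (by exact hz), indicator_of_notMem (by exact hz)]

/-- Comparison principle: a time-dependent supersolution of the equation satisfied by the expected
additive functional up to the regeneration time dominates it. -/
lemma tsum_survivalExp_le (h : SmallSet P C ε ν) (x : X) {g W : ℕ → X → ℝ≥0∞}
    (hg : ∀ n, Measurable (g n)) (hW : ∀ n, Measurable (W n))
    (hgW : ∀ n y, g n y + keepWeight C ε y * ∫⁻ z, W (n + 1) z ∂(residualKernel h y) ≤ W n y) :
    ∑' n, survivalExp h (Measure.dirac x) n (fun z => g n z.1) ≤ W 0 x := by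
  -- The remainder `W n` on survival to time `n` is kept in the induction: each step converts part
  -- of it into the next term of the sum.
  have step : ∀ n, (∑ k ∈ Finset.range n, survivalExp h (Measure.dirac x) k (fun z => g k z.1)) +
      survivalExp h (Measure.dirac x) n (fun z => W n z.1) ≤ W 0 x := by
    intro n
    induction n with
    | zero =>
      rw [Finset.sum_range_zero, zero_add,
        survivalExp_zero h _ (G := fun z => W 0 z.1) ((hW 0).comp measurable_fst),
        lintegral_splitMeasure_fst h _ (hW 0), lintegral_dirac' _ (hW 0)]
    | succ n ih =>
      refine le_trans ?_ ih
      rw [Finset.sum_range_succ, add_assoc]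
      gcongr
      rw [survivalExp_succ_fst h _ n (hW (n + 1)),
        ← survivalExp_add h _ n (G := fun z => g n z.1) ((hg n).comp measurable_fst)]
      exact survivalExp_mono h _ n fun z => hgW n z.1
  refine ENNReal.tsum_le_of_sum_range_le fun n => le_trans le_self_add (step n)

lemma lintegral_excursionSum (h : SmallSet P C ε ν) (μ : Measure X) {g : ℕ → X → ℝ}
    (hg : ∀ n, Measurable (g n)) :
    ∫⁻ ω, excursionSum (fun k w => g k (w k).1) ω ∂(splitChain h μ) =
      ∑' n, survivalExp h μ n (fun z => ENNReal.ofReal (g n z.1)) := by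
  simp_rw [excursionSum_eq_tsum]
  rw [lintegral_tsum]
  · rfl
  · intro k
    refine Measurable.aemeasurable (Measurable.indicator ?_ (measurableSet_noRegen k))
    exact ((hg k).comp (measurable_fst.comp (measurable_pi_apply k))).ennreal_ofReal

lemma measurable_excursionSum {g : ℕ → X → ℝ} (hg : ∀ n, Measurable (g n)) :
    Measurable (excursionSum fun k (w : ℕ → X × Bool) => g k (w k).1) := by
  have he : (excursionSum fun k (w : ℕ → X × Bool) => g k (w k).1) = fun ω =>
      ∑' k, (noRegen k).indicator (fun ω => ENNReal.ofReal (g k (ω k).1)) ω := by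
    funext ω; exact excursionSum_eq_tsum _ ω
  rw [he]
  refine Measurable.tsum fun k => Measurable.indicator ?_ (measurableSet_noRegen k)
  exact ((hg k).comp (measurable_fst.comp (measurable_pi_apply k))).ennreal_ofReal

/-- Version of the comparison principle in terms of `P`, for supersolutions of the form
`θ_n + B_n` with constants `B_n`. -/
lemma lintegral_excursionSum_le (h : SmallSet P C ε ν) (x : X) {g w : ℕ → X → ℝ} {B : ℕ → ℝ}
    (hg : ∀ n, Measurable (g n)) (hw : ∀ n, Measurable (w n)) (hg0 : ∀ n y, 0 ≤ g n y)
    (hw0 : ∀ n y, 0 ≤ w n y)     (hB : ∀ n, 0 ≤ B n) {A : ℕ → X → ℝ}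
    (hA : ∀ n y, ∫⁻ z, ENNReal.ofReal (w (n + 1) z) ∂(P y) ≤ ENNReal.ofReal (A n y))
    (hA0 : ∀ n y, 0 ≤ A n y)
    (hgw : ∀ n y, g n y + A n y + (1 - ε * C.indicator 1 y) * B (n + 1) ≤
      w n y * Cᶜ.indicator 1 y + B n) :
    ∫⁻ ω, excursionSum (fun k v => g k (v k).1) ω ∂(splitChain h (Measure.dirac x)) ≤
      ENNReal.ofReal (w 0 x * Cᶜ.indicator 1 x + B 0) := by
  have hind : Measurable (Cᶜ.indicator (1 : X → ℝ)) :=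
    measurable_one.indicator h.measurableSet.compl
  rw [lintegral_excursionSum h _ hg]
  refine tsum_survivalExp_le h x (g := fun n y => ENNReal.ofReal (g n y))
    (W := fun n y => ENNReal.ofReal (w n y * Cᶜ.indicator 1 y + B n))
    (fun n => (hg n).ennreal_ofReal)
    (fun n => (((hw n).mul hind).add_const _).ennreal_ofReal) fun n y => ?_
  -- The indicator of `Cᶜ` is dropped after the transition, so that the drift of `w` under `P` can
  -- be used.
  have h1 : ∫⁻ z, ENNReal.ofReal (w (n + 1) z * Cᶜ.indicator 1 z + B (n + 1))
      ∂(residualKernel h y) ≤ (∫⁻ z, ENNReal.ofReal (w (n + 1) z) ∂(residualKernel h y)) +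
        ENNReal.ofReal (B (n + 1)) := by
    calc _ ≤ ∫⁻ z, (ENNReal.ofReal (w (n + 1) z) + ENNReal.ofReal (B (n + 1)))
        ∂(residualKernel h y) := by
          refine lintegral_mono fun z => ?_
          refine ENNReal.ofReal_add_le.trans ?_
          gcongr
          by_cases hz : z ∈ C <;> simp [hz, hw0]
      _ = _ := by
          rw [lintegral_add_right _ measurable_const]; simp
  calc _ ≤ ENNReal.ofReal (g n y) + keepWeight C ε y *
        ((∫⁻ z, ENNReal.ofReal (w (n + 1) z) ∂(residualKernel h y)) +
          ENNReal.ofReal (B (n + 1))) := by gcongr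
    _ ≤ ENNReal.ofReal (g n y) + (ENNReal.ofReal (A n y) +
          keepWeight C ε y * ENNReal.ofReal (B (n + 1))) := by
        rw [mul_add]
        gcongr
        exact (keepWeight_mul_lintegral_residual_le h y _).trans (hA n y)
    _ = ENNReal.ofReal (g n y + A n y + (1 - ε * C.indicator 1 y) * B (n + 1)) := by
        have hk := sub_nonneg.2 (h.weight_le_one y)
        rw [keepWeight, ← ENNReal.ofReal_mul hk,
          ← ENNReal.ofReal_add (hA0 n y) (mul_nonneg hk (hB _)),
          ← ENNReal.ofReal_add (hg0 n y) (add_nonneg (hA0 n y) (mul_nonneg hk (hB _))), add_assoc]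
    _ ≤ _ := ENNReal.ofReal_le_ofReal (hgw n y)

end Chain

/-! ### Primitives of antitone functions on `[1, ∞)`. -/

section Antitone

lemma intervalIntegrable_of_antitoneOn_Ici {h : ℝ → ℝ} (hh : AntitoneOn h (Ici 1)) {u v : ℝ}
    (hu : 1 ≤ u) (hv : 1 ≤ v) : IntervalIntegrable h volume u v := by
  refine AntitoneOn.intervalIntegrable (hh.mono fun x hx => ?_)
  exact (le_inf hu hv).trans hx.1

/-- The primitive of an antitone function lies below its tangents. -/
lemma integral_sub_integral_le {h : ℝ → ℝ} (hh : AntitoneOn h (Ici 1)) {u v : ℝ}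
    (hu : 1 ≤ u) (hv : 1 ≤ v) :
    (∫ x in (1 : ℝ)..u, h x) - (∫ x in (1 : ℝ)..v, h x) ≤ h v * (u - v) := by
  have i1 := intervalIntegrable_of_antitoneOn_Ici hh (le_refl 1) hu
  have i2 := intervalIntegrable_of_antitoneOn_Ici hh (le_refl 1) hv
  rw [intervalIntegral.integral_interval_sub_left i1 i2]
  rcases le_total v u with huv | huv
  · have := intervalIntegral.integral_mono_on huv (intervalIntegrable_of_antitoneOn_Ici hh hv hu)
      (intervalIntegrable_const (c := h v)) fun x hx => hh hv (hv.trans hx.1) hx.1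
    rw [intervalIntegral.integral_const, smul_eq_mul] at this
    linarith
  · have := intervalIntegral.integral_mono_on huv (intervalIntegrable_const (c := h v))
      (intervalIntegrable_of_antitoneOn_Ici hh hu hv) fun x hx => hh (hu.trans hx.1) hv hx.2
    rw [intervalIntegral.integral_const, smul_eq_mul] at this
    rw [intervalIntegral.integral_symm]
    linarith

lemma integral_nonneg_of_nonneg_Ici {h : ℝ → ℝ} (h0 : ∀ x, 1 ≤ x → 0 ≤ h x) {u : ℝ}
    (hu : 1 ≤ u) : 0 ≤ ∫ x in (1 : ℝ)..u, h x :=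
  intervalIntegral.integral_nonneg hu fun x hx => h0 x hx.1

lemma integral_mono_right_Ici {h : ℝ → ℝ} (hh : AntitoneOn h (Ici 1))
    (h0 : ∀ x, 1 ≤ x → 0 ≤ h x) {u v : ℝ} (hu : 1 ≤ u) (huv : u ≤ v) :
    ∫ x in (1 : ℝ)..u, h x ≤ ∫ x in (1 : ℝ)..v, h x := by
  have := integral_sub_integral_le hh hu (hu.trans huv)
  nlinarith [h0 v (hu.trans huv)]

end Antitone

/-! ### The function `Φ` and its inverse. -/

lemma Phi_one (φ : ℝ → ℝ) : Phi φ 1 = 0 := by simp [Phi]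

namespace IsDriftRate

variable {φ : ℝ → ℝ} (hφ : IsDriftRate φ)

include hφ

lemma one_le_apply {v : ℝ} (hv : 1 ≤ v) : φ 1 ≤ φ v :=
  hφ.monotone (mem_Ici.2 le_rfl) hv hv

lemma pos' {v : ℝ} (hv : 1 ≤ v) : 0 < φ v := hφ.pos.trans_le (hφ.one_le_apply hv)

lemma continuousOn : ContinuousOn φ (Ici 1) := hφ.differentiable.continuousOn

lemma differentiableAt {v : ℝ} (hv : 1 < v) : DifferentiableAt ℝ φ v :=
  hφ.differentiable.differentiableAt (Ici_mem_nhds hv)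

lemma antitoneOn_deriv : AntitoneOn (deriv φ) (Ioi 1) :=
  (hφ.concave.subset Ioi_subset_Ici_self (convex_Ioi 1)).antitoneOn_deriv
    fun _ hv => hφ.differentiableAt hv

lemma exists_le_linear {η : ℝ} (hη : 0 < η) : ∃ A, 0 ≤ A ∧ ∀ v, 1 ≤ v → φ v ≤ η * v + A := by
  obtain ⟨v₀, hv₀, hd⟩ := ((eventually_gt_atTop (1 : ℝ)).and
    (hφ.tendsto_deriv.eventually_le_const hη)).exists
  -- Monotonicity bounds `φ` before `v₀`; beyond it the slope stays below `η`, since `φ'` is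
  -- non-increasing.
  refine ⟨φ v₀, (hφ.pos' hv₀.le).le, fun v hv => ?_⟩
  rcases le_total v v₀ with h | h
  · have := hφ.monotone hv hv₀.le h
    nlinarith
  · have := (convex_Ici v₀).image_sub_le_mul_sub_of_deriv_le
      (hφ.continuousOn.mono (Ici_subset_Ici.2 hv₀.le))
      (fun x hx => by
        rw [interior_Ici] at hx
        exact (hφ.differentiableAt (hv₀.trans hx)).differentiableWithinAt)
      (fun x hx => by
        rw [interior_Ici] at hx
        exact (hφ.antitoneOn_deriv hv₀ (hv₀.trans hx) (le_of_lt hx)).trans hd)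
      v₀ (mem_Ici.2 le_rfl) v h h
    nlinarith

lemma antitoneOn_inv : AntitoneOn (fun v => 1 / φ v) (Ici 1) := fun _ hu _ hv huv =>
  one_div_le_one_div_of_le (hφ.pos' hu) (hφ.monotone hu hv huv)

lemma Phi_sub_le {u v : ℝ} (hu : 1 ≤ u) (hv : 1 ≤ v) : Phi φ u - Phi φ v ≤ (u - v) / φ v := by
  have := integral_sub_integral_le hφ.antitoneOn_inv hu hv
  unfold Phi
  rw [div_eq_mul_one_div, mul_comm]
  exact this

lemma strictMonoOn_Phi : StrictMonoOn (Phi φ) (Ici 1) := fun u hu v hv huv => by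
  have h1 := hφ.Phi_sub_le hu hv
  have h2 : (u - v) / φ v < 0 := div_neg_of_neg_of_pos (sub_neg.2 huv) (hφ.pos' hv)
  linarith

lemma Phi_nonneg {v : ℝ} (hv : 1 ≤ v) : 0 ≤ Phi φ v := by
  rw [← Phi_one φ]
  exact hφ.strictMonoOn_Phi.monotoneOn (mem_Ici.2 le_rfl) hv hv

lemma hasDerivAt_Phi {v : ℝ} (hv : 1 < v) : HasDerivAt (Phi φ) (1 / φ v) v := by
  have hc : ∀ y, 1 < y → ContinuousAt (fun v => 1 / φ v) y := fun y hy =>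
    continuousAt_const.div (hφ.differentiableAt hy).continuousAt (hφ.pos' hy.le).ne'
  refine intervalIntegral.integral_hasDerivAt_right
    (intervalIntegrable_of_antitoneOn_Ici hφ.antitoneOn_inv le_rfl hv.le) ?_ (hc v hv)
  exact (ContinuousOn.stronglyMeasurableAtFilter isOpen_Ioi
    (fun y hy => (hc y hy).continuousWithinAt) v hv)

lemma continuousOn_Phi : ContinuousOn (Phi φ) (Ici 1) := by
  have : LipschitzOnWith (Real.toNNReal (1 / φ 1)) (Phi φ) (Ici 1) := by
    refine LipschitzOnWith.of_le_add_mul' _ fun u hu v hv => ?_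
    have h1 := hφ.Phi_sub_le hu hv
    have h2 : (u - v) / φ v ≤ 1 / φ 1 * dist u v := by
      rw [Real.dist_eq, div_eq_mul_one_div, mul_comm]
      calc _ ≤ 1 / φ v * |u - v| := by
            have := hφ.pos' hv
            gcongr; exact le_abs_self _
        _ ≤ _ := by
            have := hφ.pos
            gcongr; exact hφ.one_le_apply hv
    linarith
  exact this.continuousOn

/-- At most linear growth of `φ` makes `Φ` grow at least logarithmically. -/
lemma tendsto_Phi : Tendsto (Phi φ) atTop atTop := by
  obtain ⟨A, hA, hle⟩ := hφ.exists_le_linear one_pos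
  have hlog : ∀ v, 1 ≤ v → Real.log (v + A) - Real.log (1 + A) ≤ Phi φ v := by
    intro v hv
    have hcd : ∀ x ∈ uIcc 1 v, HasDerivAt (fun x => Real.log (x + A)) (1 / (x + A)) x := by
      intro x hx
      rw [uIcc_of_le hv] at hx
      have := ((hasDerivAt_id x).add_const A).log (by simp only [id]; linarith [hx.1])
      simpa using this
    have hcont : ContinuousOn (fun x : ℝ => 1 / (x + A)) (uIcc 1 v) := by
      refine continuousOn_const.div (by fun_prop) fun x hx => ?_
      rw [uIcc_of_le hv] at hx
      linarith [hx.1]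
    rw [← intervalIntegral.integral_eq_sub_of_hasDerivAt hcd hcont.intervalIntegrable]
    refine intervalIntegral.integral_mono_on hv hcont.intervalIntegrable
      (intervalIntegrable_of_antitoneOn_Ici hφ.antitoneOn_inv le_rfl hv) fun x hx => ?_
    exact one_div_le_one_div_of_le (hφ.pos' hx.1) (by simpa using hle x hx.1)
  have ht : Tendsto (fun v : ℝ => Real.log (v + A) - Real.log (1 + A)) atTop atTop :=
    tendsto_atTop_add_const_right _ _
      (Real.tendsto_log_atTop.comp (tendsto_atTop_add_const_right _ _ tendsto_id))
  exact tendsto_atTop_mono' _ ((eventually_ge_atTop 1).mono hlog) ht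

lemma surjOn_Phi : SurjOn (Phi φ) (Ici 1) (Ici 0) := by
  intro u hu
  obtain ⟨v, hv1, hv⟩ := ((eventually_ge_atTop (1 : ℝ)).and
    (hφ.tendsto_Phi.eventually_ge_atTop u)).exists
  have := intermediate_value_Icc hv1 (hφ.continuousOn_Phi.mono Icc_subset_Ici_self)
  obtain ⟨w, hw, hwu⟩ := this ⟨by rw [Phi_one]; exact hu, hv⟩
  exact ⟨w, hw.1, hwu⟩

lemma one_le_PhiInv {u : ℝ} (hu : 0 ≤ u) : 1 ≤ PhiInv φ u :=
  Function.invFunOn_mem (hφ.surjOn_Phi hu)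

lemma Phi_PhiInv {u : ℝ} (hu : 0 ≤ u) : Phi φ (PhiInv φ u) = u :=
  Function.invFunOn_eq (hφ.surjOn_Phi hu)

lemma PhiInv_Phi {v : ℝ} (hv : 1 ≤ v) : PhiInv φ (Phi φ v) = v :=
  hφ.strictMonoOn_Phi.injOn (hφ.one_le_PhiInv (hφ.Phi_nonneg hv)) hv
    (hφ.Phi_PhiInv (hφ.Phi_nonneg hv))

lemma PhiInv_zero : PhiInv φ 0 = 1 := by
  rw [← Phi_one φ, hφ.PhiInv_Phi le_rfl]

lemma PhiInv_mono {s t : ℝ} (hs : 0 ≤ s) (hst : s ≤ t) : PhiInv φ s ≤ PhiInv φ t := by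
  refine (hφ.strictMonoOn_Phi.le_iff_le (hφ.one_le_PhiInv hs)
    (hφ.one_le_PhiInv (hs.trans hst))).1 ?_
  rwa [hφ.Phi_PhiInv hs, hφ.Phi_PhiInv (hs.trans hst)]

/-- The tangent inequality of the convex function `Φ⁻¹`. As `s` may lie on either side of `t`, it
yields both upper and lower bounds for increments. -/
lemma PhiInv_sub_le {s t : ℝ} (hs : 0 ≤ s) (ht : 0 ≤ t) :
    PhiInv φ s - PhiInv φ t ≤ φ (PhiInv φ s) * (s - t) := by
  have h1 := hφ.Phi_sub_le (hφ.one_le_PhiInv ht) (hφ.one_le_PhiInv hs)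
  rw [hφ.Phi_PhiInv hs, hφ.Phi_PhiInv ht, le_div_iff₀ (hφ.pos' (hφ.one_le_PhiInv hs))] at h1
  linarith

lemma continuousOn_PhiInv : ContinuousOn (PhiInv φ) (Ici 0) := by
  intro t ht
  have hT : 0 ≤ t + 1 := by linarith [mem_Ici.1 ht]
  have hL : LipschitzOnWith (Real.toNNReal (φ (PhiInv φ (t + 1)))) (PhiInv φ) (Icc 0 (t + 1)) := by
    refine LipschitzOnWith.of_le_add_mul' _ fun r hr s hs => ?_
    have h1 := hφ.PhiInv_sub_le hr.1 hs.1
    have h2 : φ (PhiInv φ r) * (r - s) ≤ φ (PhiInv φ (t + 1)) * dist r s := by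
      rw [Real.dist_eq]
      have h3 := hφ.pos' (hφ.one_le_PhiInv hr.1)
      calc _ ≤ φ (PhiInv φ r) * |r - s| := by gcongr; exact le_abs_self _
        _ ≤ _ := by
          gcongr
          exact hφ.monotone (hφ.one_le_PhiInv hr.1) (hφ.one_le_PhiInv hT)
            (hφ.PhiInv_mono hr.1 hr.2)
    linarith
  refine (hL.continuousOn t ⟨ht, by linarith⟩).mono_of_mem_nhdsWithin ?_
  rw [← Ici_inter_Iic]
  exact inter_mem self_mem_nhdsWithin (mem_nhdsWithin_of_mem_nhds (Iic_mem_nhds (by linarith)))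

lemma hasDerivAt_PhiInv {u : ℝ} (hu : 0 < u) :
    HasDerivAt (PhiInv φ) (φ (PhiInv φ u)) u := by
  have h1 : 1 < PhiInv φ u := by
    refine lt_of_le_of_ne (hφ.one_le_PhiInv hu.le) fun h => hu.ne ?_
    rw [← hφ.Phi_PhiInv hu.le, ← h, Phi_one]
  have := HasDerivAt.of_local_left_inverse (f := Phi φ) (g := PhiInv φ)
    (hφ.continuousOn_PhiInv.continuousAt (Ici_mem_nhds hu)) (hφ.hasDerivAt_Phi h1)
    (one_div_pos.2 (hφ.pos' h1.le)).ne'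
    ((eventually_gt_nhds hu).mono fun y hy => hφ.Phi_PhiInv hy.le)
  simpa using this

end IsDriftRate

/-! ### The flow of `φ` and its concavity in the initial value. -/

/-- The flow of the differential equation `ẇ = φ(w)`. -/
def flow (φ : ℝ → ℝ) (t v : ℝ) : ℝ := PhiInv φ (Phi φ v + t)

lemma flow_one (φ : ℝ → ℝ) (t : ℝ) : flow φ t 1 = PhiInv φ t := by rw [flow, Phi_one, zero_add]

namespace IsDriftRate

variable {φ : ℝ → ℝ} (hφ : IsDriftRate φ)

include hφ

lemma one_le_flow {t v : ℝ} (ht : 0 ≤ t) (hv : 1 ≤ v) : 1 ≤ flow φ t v :=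
  hφ.one_le_PhiInv (add_nonneg (hφ.Phi_nonneg hv) ht)

lemma flow_zero {v : ℝ} (hv : 1 ≤ v) : flow φ 0 v = v := by
  rw [flow, add_zero, hφ.PhiInv_Phi hv]

lemma flow_mono {t v w : ℝ} (ht : 0 ≤ t) (hv : 1 ≤ v) (hvw : v ≤ w) : flow φ t v ≤ flow φ t w :=
  hφ.PhiInv_mono (add_nonneg (hφ.Phi_nonneg hv) ht)
    (by linarith [hφ.strictMonoOn_Phi.monotoneOn hv (hv.trans hvw) hvw])

lemma le_flow {t v : ℝ} (ht : 0 ≤ t) (hv : 1 ≤ v) : v ≤ flow φ t v := by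
  calc v = PhiInv φ (Phi φ v) := (hφ.PhiInv_Phi hv).symm
    _ ≤ _ := hφ.PhiInv_mono (hφ.Phi_nonneg hv) (by linarith)

lemma flow_add_one_sub_le {t v : ℝ} (ht : 0 ≤ t) (hv : 1 ≤ v) :
    flow φ (t + 1) v - flow φ t v ≤ φ (flow φ (t + 1) v) := by
  have := hφ.PhiInv_sub_le (s := Phi φ v + (t + 1)) (t := Phi φ v + t)
    (by linarith [hφ.Phi_nonneg hv]) (by linarith [hφ.Phi_nonneg hv])
  unfold flow
  linarith

lemma le_flow_add_one_sub {t v : ℝ} (ht : 0 ≤ t) (hv : 1 ≤ v) :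
    φ (flow φ t v) ≤ flow φ (t + 1) v - flow φ t v := by
  have := hφ.PhiInv_sub_le (t := Phi φ v + (t + 1)) (s := Phi φ v + t)
    (by linarith [hφ.Phi_nonneg hv]) (by linarith [hφ.Phi_nonneg hv])
  unfold flow
  linarith

lemma hasDerivAt_flow {t v : ℝ} (ht : 0 ≤ t) (hv : 1 < v) :
    HasDerivAt (flow φ t) (φ (flow φ t v) / φ v) v := by
  have hpos : 0 < Phi φ v + t := by
    have := hφ.strictMonoOn_Phi (mem_Ici.2 le_rfl) hv.le hv
    rw [Phi_one] at this
    linarith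
  have := (hφ.hasDerivAt_PhiInv hpos).comp v ((hφ.hasDerivAt_Phi hv).add_const t)
  rw [mul_one_div] at this
  exact this

lemma continuousOn_flow {t : ℝ} (ht : 0 ≤ t) : ContinuousOn (flow φ t) (Ici 1) :=
  hφ.continuousOn_PhiInv.comp (hφ.continuousOn_Phi.add continuousOn_const)
    fun _ hv => add_nonneg (hφ.Phi_nonneg hv) ht

/-- The derivative of this ratio has the sign of `φ'(flow) - φ'(v)`, which is nonpositive because
the flow moves upwards and `φ` is concave. -/
lemma antitoneOn_flow_slope {t : ℝ} (ht : 0 ≤ t) :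
    AntitoneOn (fun v => φ (flow φ t v) / φ v) (Ici 1) := by
  have hd : ∀ v, 1 < v → HasDerivAt (fun v => φ (flow φ t v) / φ v)
      ((deriv φ (flow φ t v) * (φ (flow φ t v) / φ v) * φ v - φ (flow φ t v) * deriv φ v) /
        φ v ^ 2) v := by
    intro v hv
    have h1 : 1 < flow φ t v := hv.trans_le (hφ.le_flow ht hv.le)
    exact ((hφ.differentiableAt h1).hasDerivAt.comp v (hφ.hasDerivAt_flow ht hv)).div
      (hφ.differentiableAt hv).hasDerivAt (hφ.pos' hv.le).ne'
  refine antitoneOn_of_deriv_nonpos (convex_Ici 1) ?_ ?_ ?_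
  · exact (hφ.continuousOn.comp (hφ.continuousOn_flow ht) fun v hv => hφ.one_le_flow ht hv).div
      hφ.continuousOn fun v hv => (hφ.pos' hv).ne'
  · rw [interior_Ici]
    exact fun v hv => (hd v hv).differentiableAt.differentiableWithinAt
  · rw [interior_Ici]
    intro v hv
    have h0 := hφ.le_flow ht (le_of_lt hv)
    have hp := hφ.pos' (le_of_lt hv)
    have hq := hφ.pos' (hφ.one_le_flow ht (le_of_lt hv))
    rw [(hd v hv).deriv, mul_assoc, div_mul_cancel₀ _ hp.ne']
    have := hφ.antitoneOn_deriv hv (lt_of_lt_of_le hv h0) h0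
    refine div_nonpos_of_nonpos_of_nonneg ?_ (by positivity)
    nlinarith

/-- The flow is concave in the initial value: it lies below its tangents. -/
lemma flow_sub_le {t u v : ℝ} (ht : 0 ≤ t) (hu : 1 ≤ u) (hv : 1 ≤ v) :
    flow φ t u - flow φ t v ≤ φ (flow φ t v) / φ v * (u - v) := by
  have mvt : ∀ a b, 1 ≤ a → a < b → ∃ c ∈ Ioo a b,
      φ (flow φ t c) / φ c = (flow φ t b - flow φ t a) / (b - a) := fun a b ha hab =>
    exists_hasDerivAt_eq_slope _ _ hab
      ((hφ.continuousOn_flow ht).mono fun x hx => ha.trans hx.1)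
      fun x hx => hφ.hasDerivAt_flow ht (ha.trans_lt hx.1)
  rcases lt_trichotomy u v with h | h | h
  · obtain ⟨c, hc, he⟩ := mvt u v hu h
    have := hφ.antitoneOn_flow_slope ht (hu.trans hc.1.le) hv hc.2.le
    simp only at this
    rw [he, le_div_iff₀ (sub_pos.2 h)] at this
    linarith
  · simp [h]
  · obtain ⟨c, hc, he⟩ := mvt v u hv h
    have := hφ.antitoneOn_flow_slope ht hv (hv.trans hc.1.le) hc.1.le
    simp only at this
    rw [he, div_le_iff₀ (sub_pos.2 h)] at this
    linarith

/-! ### Subgeometric growth of `r_φ`. -/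

lemma rate_eq (u : ℝ) : rate φ u = φ (PhiInv φ u) / φ 1 := by rw [rate, hφ.PhiInv_zero]

lemma one_le_rate {u : ℝ} (hu : 0 ≤ u) : 1 ≤ rate φ u := by
  rw [hφ.rate_eq, one_le_div hφ.pos]
  exact hφ.one_le_apply (hφ.one_le_PhiInv hu)

lemma rate_mono {s t : ℝ} (hs : 0 ≤ s) (hst : s ≤ t) : rate φ s ≤ rate φ t := by
  rw [hφ.rate_eq, hφ.rate_eq]
  have := hφ.pos
  gcongr
  exact hφ.monotone (hφ.one_le_PhiInv hs) (hφ.one_le_PhiInv (hs.trans hst))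
    (hφ.PhiInv_mono hs hst)

lemma le_sum_rate (n : ℕ) : (n : ℝ) ≤ ∑ k ∈ Finset.range n, rate φ k := by
  have := Finset.card_nsmul_le_sum (Finset.range n) (fun k : ℕ => rate φ k) 1
    fun k _ => hφ.one_le_rate (Nat.cast_nonneg k)
  simpa using this

lemma exists_PhiInv_le_sum_rate :
    ∃ D, 0 < D ∧ ∀ n : ℕ, PhiInv φ (n + 1) ≤ D * ∑ k ∈ Finset.range (n + 1), rate φ k := by
  obtain ⟨A, hA, hle⟩ := hφ.exists_le_linear (η := 1 / 2) (by norm_num)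
  have hφ1 := hφ.pos
  have hsum : ∀ n : ℕ, PhiInv φ n ≤ 1 + φ 1 * ∑ k ∈ Finset.range (n + 1), rate φ k := by
    intro n
    induction n with
    | zero => simp [hφ.PhiInv_zero, rate, hφ.pos.ne', hφ.pos.le]
    | succ n ih =>
      rw [Finset.sum_range_succ]
      have h1 := hφ.PhiInv_sub_le (s := ((n + 1 : ℕ) : ℝ)) (t := n) (by positivity) (by positivity)
      have h2 : φ 1 * rate φ (n + 1 : ℕ) = φ (PhiInv φ (n + 1 : ℕ)) := by
        rw [hφ.rate_eq]; field_simp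
      push_cast at h1 h2 ⊢
      nlinarith
  -- The sum stops at `n` although the left side is at `n + 1`: the last increment is at most
  -- `φ(Φ⁻¹(n+1)) ≤ Φ⁻¹(n+1) / 2 + A`, and the half is absorbed, giving the factor `2`. The
  -- constants are absorbed since the sum is at least `1`.
  refine ⟨2 * (1 + φ 1 + A), by positivity, fun n => ?_⟩
  have h1 := hφ.PhiInv_sub_le (s := (n + 1 : ℝ)) (t := n) (by positivity) (by positivity)
  have h2 := hle _ (hφ.one_le_PhiInv (u := (n + 1 : ℝ)) (by positivity))
  have h3 := hsum n
  have h4 := hφ.le_sum_rate (n + 1)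
  push_cast at h4
  have h5 : (0 : ℝ) ≤ n := Nat.cast_nonneg n
  nlinarith

lemma exists_rate_le_sum {η : ℝ} (hη : 0 < η) :
    ∃ A, 0 ≤ A ∧ ∀ n : ℕ, rate φ (n + 1) ≤ η * ∑ k ∈ Finset.range (n + 1), rate φ k + A := by
  obtain ⟨D, hD, hle⟩ := hφ.exists_PhiInv_le_sum_rate
  have hφ1 := hφ.pos
  obtain ⟨A, hA, hA'⟩ := hφ.exists_le_linear (η := η * φ 1 / D) (by positivity)
  refine ⟨A / φ 1, by positivity, fun n => ?_⟩
  rw [hφ.rate_eq, div_le_iff₀ hφ1]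
  have h1 := hA' _ (hφ.one_le_PhiInv (u := (n + 1 : ℝ)) (by positivity))
  have h2 : η * φ 1 / D * PhiInv φ (n + 1) ≤
      η * φ 1 / D * (D * ∑ k ∈ Finset.range (n + 1), rate φ k) := by
    gcongr; exact hle n
  have h3 : η * φ 1 / D * (D * ∑ k ∈ Finset.range (n + 1), rate φ k) =
      η * (∑ k ∈ Finset.range (n + 1), rate φ k) * φ 1 := by field_simp
  have h4 : (η * ∑ k ∈ Finset.range (n + 1), rate φ k + A / φ 1) * φ 1 =
    η * (∑ k ∈ Finset.range (n + 1), rate φ k) * φ 1 + A := by field_simp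
  linarith

/-- If `ψ(v) < 0`, then `ψ(w) ≤ (ψ(v) / φ(v)) φ(w)` falls below `ψ(v)` once `φ(w) > φ(v)`, against
monotonicity. -/
lemma nonneg_of_mem_G {ψ : ℝ → ℝ} (hψ : ψ ∈ G φ) {v : ℝ} (hv : 1 ≤ v) : 0 ≤ ψ v := by
  by_contra! hneg
  have hc : ψ v / φ v < 0 := div_neg_of_neg_of_pos hneg (hφ.pos' hv)
  obtain ⟨w, hw, hw'⟩ := ((eventually_ge_atTop v).and
    (hφ.tendsto_atTop.eventually_gt_atTop (φ v))).exists
  have h1 := hψ.1 hv (hv.trans hw) hw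
  have h2 := hψ.2 hv (hv.trans hw) hw
  simp only at h2
  rw [div_le_iff₀ (hφ.pos' (hv.trans hw))] at h2
  have h3 : ψ v / φ v * φ v = ψ v := div_mul_cancel₀ _ (hφ.pos' hv).ne'
  nlinarith

end IsDriftRate

/-! ### Pathwise comparison of excursion sums. -/

section Excursion

variable {X : Type*}

lemma excursionSum_le_add {g g₁ g₂ : ℕ → (ℕ → X × Bool) → ℝ} {ω : ℕ → X × Bool}
    (hg : ∀ k, g k ω ≤ g₁ k ω + g₂ k ω) :
    excursionSum g ω ≤ excursionSum g₁ ω + excursionSum g₂ ω := by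
  rw [excursionSum_eq_tsum, excursionSum_eq_tsum, excursionSum_eq_tsum, ← ENNReal.tsum_add]
  refine ENNReal.tsum_le_tsum fun k => ?_
  by_cases hk : ω ∈ noRegen k
  · simp only [indicator_of_mem hk]
    exact (ENNReal.ofReal_le_ofReal (hg k)).trans ENNReal.ofReal_add_le
  · simp [hk]

/-- The index `n` is the regeneration time; it serves all `g` at once, so that different sums over
one path can be compared. -/
lemma forall_noRegen_or_exists_excursionSum_eq (ω : ℕ → X × Bool) :
    (∀ k, ω ∈ noRegen k) ∨ ∃ n, ∀ g : ℕ → (ℕ → X × Bool) → ℝ,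
      excursionSum g ω = ∑ k ∈ Finset.range (n + 1), ENNReal.ofReal (g k ω) := by
  classical
  by_cases hall : ∀ j, (ω j).2 = false
  · exact .inl fun k j _ => hall j
  · right
    push Not at hall
    refine ⟨Nat.find hall, fun g => ?_⟩
    have hmem : ∀ k, ω ∈ noRegen k ↔ k ≤ Nat.find hall := by
      intro k
      rw [Nat.le_find_iff]
      exact ⟨fun h j hj => not_not.2 (h j hj), fun h j hj => not_not.1 (h j hj)⟩
    rw [excursionSum_eq_tsum, tsum_eq_sum (s := Finset.range (Nat.find hall + 1))]
    · refine Finset.sum_congr rfl fun k hk => ?_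
      rw [indicator_of_mem ((hmem k).2 (Nat.lt_succ_iff.1 (Finset.mem_range.1 hk)))]
    · intro k hk
      rw [indicator_of_notMem]
      rw [hmem]
      simpa [Nat.lt_succ_iff] using hk

/-- A lower bound for the excursion sum of the rate function in terms of excursion sums of
bounded functions. -/
lemma exists_PhiInv_le_excursionSum_rate {φ : ℝ → ℝ} (hφ : IsDriftRate φ) :
    ∃ D, 0 < D ∧ ∀ {X : Type u} (ω : ℕ → X × Bool)
      (g : ℕ → (ℕ → X × Bool) → ℝ) (m T : ℝ), 0 < m → 0 < T → (∀ k, 0 ≤ g k ω) →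
      (∀ k, g k ω ≤ m) → ENNReal.ofReal T ≤ excursionSum g ω →
      ENNReal.ofReal (PhiInv φ (T / m) / D) ≤ excursionSum (fun k _ => rate φ k) ω := by
  obtain ⟨D, hD, hle⟩ := hφ.exists_PhiInv_le_sum_rate
  refine ⟨D, hD, fun {X} ω g m T hm hT hg0 hgm hTg => ?_⟩
  -- Without regeneration the sum of rates is infinite, as each is at least `1`. Otherwise `T ≤ (n +
  -- 1) m`, hence `Φ⁻¹(T / m) ≤ Φ⁻¹(n + 1)`.
  rcases forall_noRegen_or_exists_excursionSum_eq ω with hall | ⟨n, hn⟩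
  · have : excursionSum (fun k _ => rate φ k) ω = ⊤ := by
      rw [excursionSum_eq_tsum, ← top_le_iff,
        ← ENNReal.tsum_const_eq_top_of_ne_zero (α := ℕ) one_ne_zero]
      refine ENNReal.tsum_le_tsum fun k => ?_
      rw [indicator_of_mem (hall k), ENNReal.one_le_ofReal]
      exact hφ.one_le_rate (Nat.cast_nonneg k)
    rw [this]
    exact le_top
  · rw [hn, ← ENNReal.ofReal_sum_of_nonneg fun k _ => hg0 k,
      ENNReal.ofReal_le_ofReal_iff (Finset.sum_nonneg fun k _ => hg0 k)] at hTg
    have h1 := Finset.sum_le_card_nsmul (Finset.range (n + 1)) (fun k => g k ω) m fun k _ => hgm k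
    rw [Finset.card_range, nsmul_eq_mul] at h1
    push_cast at h1
    rw [hn, ← ENNReal.ofReal_sum_of_nonneg fun k _ =>
      zero_le_one.trans (hφ.one_le_rate (Nat.cast_nonneg k))]
    refine ENNReal.ofReal_le_ofReal ?_
    rw [div_le_iff₀ hD, mul_comm]
    refine le_trans (hφ.PhiInv_mono (by positivity) ?_) (hle n)
    rw [div_le_iff₀ hm]
    exact hTg.trans h1

end Excursion

/-! ### Drift of concave functions of `V` and the moment bounds (i) and (ii). -/

section Drift

variable {X : Type*} [MeasurableSpace X] {P : Kernel X X} [IsMarkovKernel P] {C : Set X}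
  {ε : ℝ} {ν : Measure X} {φ : ℝ → ℝ} {V : X → ℝ} {b R : ℝ}

lemma measurable_comp_of_monotoneOn {f : ℝ → ℝ} (hf : MonotoneOn f (Ici 1)) {V : X → ℝ}
    (hV : Measurable V) (hV1 : ∀ x, 1 ≤ V x) : Measurable fun x => f (V x) := by
  have hm : Monotone fun v => f (max v 1) := fun u v huv =>
    hf (mem_Ici.2 (le_max_right u 1)) (mem_Ici.2 (le_max_right v 1)) (max_le_max_right 1 huv)
  have he : (fun x => f (V x)) = (fun v => f (max v 1)) ∘ V := by
    funext x
    simp [hV1 x]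
  exact he ▸ hm.measurable.comp hV

/-- A function of `V` lying below an affine function inherits the drift inequality. -/
lemma DriftCondition.lintegral_le (hV : DriftCondition P C φ V b R) (x : X) {θ : ℝ → ℝ}
    {s t : ℝ} (hs : 0 ≤ s) (ht : 0 ≤ t) (hθ0 : ∀ u, 1 ≤ u → 0 ≤ θ u)
    (hθ : ∀ u, 1 ≤ u → θ u ≤ t + s * (u - V x)) :
    0 ≤ t + s * (b * C.indicator 1 x - φ (V x)) ∧
      ∫⁻ y, ENNReal.ofReal (θ (V y)) ∂(P x) ≤
        ENNReal.ofReal (t + s * (b * C.indicator 1 x - φ (V x))) := by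
  set E := V x - φ (V x) + b * C.indicator 1 x with hE
  -- As `V ≥ 1`, so is its mean. Hence `ENNReal.ofReal` truncates nothing in the drift inequality,
  -- and the affine bound at `E` is nonnegative.
  have hE1 : 1 ≤ E := by
    have h1 : (1 : ℝ≥0∞) ≤ ∫⁻ y, ENNReal.ofReal (V y) ∂(P x) := by
      calc (1 : ℝ≥0∞) = ∫⁻ _, 1 ∂(P x) := by simp
        _ ≤ _ := lintegral_mono fun y => ENNReal.one_le_ofReal.2 (hV.one_le y)
    exact ENNReal.one_le_ofReal.1 (h1.trans (hV.drift x))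
  have hEs : t + s * (b * C.indicator 1 x - φ (V x)) = t + s * (E - V x) := by rw [hE]; ring
  rw [hEs]
  have h0 : 0 ≤ t + s * (E - V x) := (hθ0 E hE1).trans (hθ E hE1)
  refine ⟨h0, ?_⟩
  have hv : 0 ≤ s * V x := mul_nonneg hs (zero_le_one.trans (hV.one_le x))
  -- Adding `s * V x` to both sides keeps all terms nonnegative.
  have key : (∫⁻ y, ENNReal.ofReal (θ (V y)) ∂(P x)) + ENNReal.ofReal (s * V x) ≤
      ENNReal.ofReal (t + s * (E - V x)) + ENNReal.ofReal (s * V x) := by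
    calc _ = ∫⁻ y, (ENNReal.ofReal (θ (V y)) + ENNReal.ofReal (s * V x)) ∂(P x) := by
          rw [lintegral_add_right _ measurable_const]; simp
      _ ≤ ∫⁻ y, (ENNReal.ofReal t + ENNReal.ofReal s * ENNReal.ofReal (V y)) ∂(P x) := by
          refine lintegral_mono fun y => ?_
          have h1 := hV.one_le y
          rw [← ENNReal.ofReal_add (hθ0 _ h1) hv, ← ENNReal.ofReal_mul hs,
            ← ENNReal.ofReal_add ht (by positivity)]
          refine ENNReal.ofReal_le_ofReal ?_
          linarith [hθ _ h1]
      _ = ENNReal.ofReal t + ENNReal.ofReal s * ∫⁻ y, ENNReal.ofReal (V y) ∂(P x) := by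
          rw [lintegral_add_left measurable_const,
            lintegral_const_mul _ hV.measurable.ennreal_ofReal]
          simp
      _ ≤ ENNReal.ofReal t + ENNReal.ofReal s * ENNReal.ofReal E := by
          gcongr; exact hV.drift x
      _ = _ := by
          rw [← ENNReal.ofReal_mul hs, ← ENNReal.ofReal_add ht (by positivity),
            ← ENNReal.ofReal_add h0 hv]
          congr 1; ring
  exact (ENNReal.add_le_add_iff_right ENNReal.ofReal_ne_top).1 key

/-- Bound on the modulated moments of the regeneration time. -/
lemma lintegral_excursionSum_comp_le (hb : 0 < b) (h : SmallSet P C ε ν)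
    (hV : DriftCondition P C φ V b R) {f g : ℝ → ℝ} (hf : AntitoneOn f (Ici 1))
    (hf0 : ∀ v, 1 ≤ v → 0 ≤ f v) (hg : Measurable fun x => g (V x))
    (hg0 : ∀ v, 1 ≤ v → 0 ≤ g v) (hgf : ∀ v, 1 ≤ v → g v ≤ f v * φ v) (x : X) :
    ∫⁻ ω, excursionSum (fun k w => g (V (w k).1)) ω ∂(splitChain h (Measure.dirac x)) ≤
      ENNReal.ofReal ((∫ u in (1 : ℝ)..V x, f u) * Cᶜ.indicator 1 x +
        ((∫ u in (1 : ℝ)..max R 1, f u) + b * f 1) / ε) := by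
  have hε := h.eps_pos
  set H : ℝ → ℝ := fun v => ∫ u in (1 : ℝ)..v, f u with hH
  have hH0 : ∀ v, 1 ≤ v → 0 ≤ H v := fun v hv => integral_nonneg_of_nonneg_Ici hf0 hv
  have hHmono : MonotoneOn H (Ici 1) := fun u hu v _ huv => integral_mono_right_Ici hf hf0 hu huv
  have hBnn : 0 ≤ (H (max R 1) + b * f 1) / ε := by
    have := hH0 (max R 1) (le_max_right _ _)
    have := hf0 1 le_rfl
    positivity
  have hdr := fun y => hV.lintegral_le y (θ := H) (s := f (V y)) (t := H (V y))
    (hf0 _ (hV.one_le y)) (hH0 _ (hV.one_le y)) hH0 fun u hu => by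
      linarith [integral_sub_integral_le hf hu (hV.one_le y)]
  refine lintegral_excursionSum_le h x (g := fun _ y => g (V y)) (w := fun _ y => H (V y))
    (B := fun _ => (H (max R 1) + b * f 1) / ε)
    (A := fun _ y => H (V y) + f (V y) * (b * C.indicator 1 y - φ (V y)))
    (fun _ => hg) (fun _ => measurable_comp_of_monotoneOn hHmono hV.measurable hV.one_le)
    (fun _ y => hg0 _ (hV.one_le y)) (fun _ y => hH0 _ (hV.one_le y)) (fun _ => hBnn)
    (fun _ y => (hdr y).2) (fun _ y => (hdr y).1) fun _ y => ?_
  -- On `C` the inequality reduces to `H(V) + b f(V) ≤ ε B`, which dictates the constant; off `C`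
  -- the drift `-f(V) φ(V)` compensates `g`.
  have h1 := hgf _ (hV.one_le y)
  by_cases hy : y ∈ C
  · simp only [hy, indicator_of_mem, Pi.one_apply, mul_one, mem_compl_iff, not_true_eq_false,
      not_false_eq_true, indicator_of_notMem, mul_zero, zero_add]
    have h2 : H (V y) ≤ H (max R 1) := hHmono (hV.one_le y) (le_max_right R 1)
      ((hV.le_on y hy).trans (le_max_left _ _))
    have h3 : f (V y) ≤ f 1 := hf (mem_Ici.2 le_rfl) (hV.one_le y) (hV.one_le y)
    have h4 : ε * ((H (max R 1) + b * f 1) / ε) = H (max R 1) + b * f 1 := by field_simp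
    nlinarith
  · simp only [hy, mem_compl_iff, not_false_eq_true, indicator_of_mem, Pi.one_apply, mul_one,
      indicator_of_notMem, mul_zero, sub_zero, one_mul, zero_sub]
    nlinarith

/-- Bound on the subgeometric moments of the regeneration time. -/
lemma exists_lintegral_excursionSum_rate_le (hφ : IsDriftRate φ) (hε : 0 < ε) (hb : 0 < b) (R : ℝ)
    {δ : ℝ} (hδ : 0 < δ) : ∃ B : ℝ, 0 ≤ B ∧
      ∀ {X : Type u} [MeasurableSpace X] {P : Kernel X X} [IsMarkovKernel P] {C : Set X}
        {ν : Measure X} {V : X → ℝ} (h : SmallSet P C ε ν) (_ : DriftCondition P C φ V b R)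
        (x : X),
        ∫⁻ ω, excursionSum (fun k _ => rate φ k) ω ∂(splitChain h (Measure.dirac x)) ≤
          ENNReal.ofReal ((1 + δ) * (V x / φ 1) * Cᶜ.indicator 1 x + B) := by
  have hφ1 := hφ.pos
  have hR : 1 ≤ max R 1 := le_max_right _ _
  set q := (1 + δ) / φ 1 with hq
  have hq0 : 0 < q := by positivity
  set L := q * (max R 1 - 1 + b) with hL
  have hL0 : 0 < L := by
    exact mul_pos hq0 (by linarith)
  -- `L r_φ(n+1)` bounds the error on `C` at time `n`; this `η` makes it at most `ε B_{n+1}` for the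
  -- `B` below.
  obtain ⟨A, hA, hAr⟩ := hφ.exists_rate_le_sum (η := δ * ε / L) (by positivity)
  refine ⟨L * A / ε, by positivity, fun {X} _ {P} _ {C} {ν} {V} h hV x => ?_⟩
  have hrate0 : ∀ k : ℕ, 0 ≤ rate φ k := fun k =>
    zero_le_one.trans (hφ.one_le_rate (Nat.cast_nonneg k))
  set B : ℕ → ℝ := fun n => L * A / ε + δ * ∑ k ∈ Finset.range n, rate φ k with hB
  have hB0 : ∀ n, 0 ≤ B n := fun n => by
    have := Finset.sum_nonneg fun k (_ : k ∈ Finset.range n) => hrate0 k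
    positivity
  have hBL : ∀ n : ℕ, L * rate φ (n + 1) ≤ ε * B (n + 1) := fun n => by
    calc L * rate φ (n + 1)
        ≤ L * (δ * ε / L * ∑ k ∈ Finset.range (n + 1), rate φ k + A) := by gcongr; exact hAr n
      _ = ε * B (n + 1) := by rw [hB]; field_simp; ring
  -- Subtracting the flow from `1` creates the gain: that flow increases by at least `φ(1) r_φ(n)`
  -- in a unit of time, while the flow from `v` increases by no more than its drift recovers.
  set θ : ℕ → ℝ → ℝ := fun n v => q * (flow φ n v - flow φ n 1) with hθ
  have hθ0 : ∀ n v, 1 ≤ v → 0 ≤ θ n v := fun n v hv =>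
    mul_nonneg hq0.le (sub_nonneg.2 (hφ.flow_mono (Nat.cast_nonneg n) le_rfl hv))
  have hθmono : ∀ n, MonotoneOn (θ n) (Ici 1) := fun n u hu v _ huv => by
    have := hφ.flow_mono (Nat.cast_nonneg n) hu huv
    simp only [hθ]
    gcongr
  set s : ℕ → ℝ → ℝ := fun n v => q * (φ (flow φ (n + 1 : ℕ) v) / φ v) with hs
  have hs0 : ∀ n v, 1 ≤ v → 0 ≤ s n v := fun n v hv => by
    have := hφ.pos' hv
    have := hφ.pos' (hφ.one_le_flow (Nat.cast_nonneg (n + 1)) hv)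
    simp only [hs]
    positivity
  have hdr := fun n y => hV.lintegral_le y (θ := θ (n + 1)) (s := s n (V y))
    (t := θ (n + 1) (V y)) (hs0 n _ (hV.one_le y)) (hθ0 _ _ (hV.one_le y)) (hθ0 _)
    fun u hu => by
      have := hφ.flow_sub_le (t := ((n + 1 : ℕ) : ℝ)) (Nat.cast_nonneg (n + 1)) hu (hV.one_le y)
      simp only [hθ, hs]
      nlinarith
  refine (lintegral_excursionSum_le h x (g := fun n _ => rate φ n) (w := fun n y => θ n (V y))
    (B := B) (A := fun n y => θ (n + 1) (V y) + s n (V y) * (b * C.indicator 1 y - φ (V y)))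
    (fun _ => measurable_const)
    (fun n => measurable_comp_of_monotoneOn (hθmono n) hV.measurable hV.one_le)
    (fun n _ => hrate0 n) (fun n y => hθ0 n _ (hV.one_le y)) hB0
    (fun n y => (hdr n y).2) (fun n y => (hdr n y).1) fun n y => ?_).trans ?_
  · have hv := hV.one_le y
    have hn : (0 : ℝ) ≤ n := Nat.cast_nonneg n
    have hBsucc : B (n + 1) = B n + δ * rate φ n := by
      simp only [hB, Finset.sum_range_succ]; ring
    have hqφ : q * φ 1 = 1 + δ := by rw [hq]; field_simp
    have hr : φ 1 * rate φ n = φ (flow φ n 1) := by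
      rw [hφ.rate_eq, flow_one]; field_simp
    have hr' : φ 1 * rate φ (n + 1) = φ (flow φ (n + 1) 1) := by
      rw [hφ.rate_eq, flow_one]; field_simp
    have hsφ : s n (V y) * φ (V y) = q * φ (flow φ (n + 1) (V y)) := by
      have := (hφ.pos' hv).ne'
      simp only [hs]; push_cast; field_simp
    have h1 := hφ.flow_add_one_sub_le hn hv
    have h2 := hφ.le_flow_add_one_sub hn (le_refl (1 : ℝ))
    have hdrift : θ (n + 1) (V y) - s n (V y) * φ (V y) ≤ θ n (V y) - (1 + δ) * rate φ n := by
      rw [hsφ, ← hqφ, mul_assoc, hr]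
      simp only [hθ]
      push_cast
      nlinarith
    by_cases hy : y ∈ C
    · simp only [hy, indicator_of_mem, Pi.one_apply, mul_one, mem_compl_iff, not_true_eq_false,
        not_false_eq_true, indicator_of_notMem, mul_zero, zero_add]
      have hVR : V y ≤ max R 1 := (hV.le_on y hy).trans (le_max_left _ _)
      have h3 : θ n (V y) ≤ q * ((max R 1 - 1) * rate φ (n + 1)) := by
        have h4 := hφ.flow_sub_le hn hv (le_refl (1 : ℝ))
        rw [← hr, mul_div_cancel_left₀ _ hφ1.ne'] at h4
        have h5 := hφ.rate_mono hn (le_add_of_nonneg_right zero_le_one : (n : ℝ) ≤ n + 1)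
        refine mul_le_mul_of_nonneg_left (h4.trans ?_) hq0.le
        rw [mul_comm]
        exact mul_le_mul (by linarith) h5 (hrate0 n) (by linarith)
      have h5 : s n (V y) ≤ q * rate φ (n + 1) := by
        have h6 := hφ.antitoneOn_flow_slope (t := (n + 1 : ℝ)) (by positivity)
          (mem_Ici.2 le_rfl) hv hv
        simp only [← hr', mul_div_cancel_left₀ _ hφ1.ne'] at h6
        simp only [hs]
        push_cast
        gcongr
      have h7 := hBL n
      have h8 := mul_le_mul_of_nonneg_right h5 hb.le
      rw [hL] at h7
      nlinarith
    · simp only [hy, mem_compl_iff, not_false_eq_true, indicator_of_mem, Pi.one_apply, mul_one,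
        indicator_of_notMem, mul_zero, sub_zero, one_mul, zero_sub]
      linarith
  · refine ENNReal.ofReal_le_ofReal ?_
    have h0 : θ 0 (V x) ≤ (1 + δ) * (V x / φ 1) := by
      simp only [hθ, Nat.cast_zero]
      rw [hφ.flow_zero (hV.one_le x), hφ.flow_zero le_rfl]
      have : (1 + δ) * (V x / φ 1) = q * V x := by rw [hq]; ring
      nlinarith
    have hB' : B 0 = L * A / ε := by simp [hB]
    rw [hB']
    gcongr
    exact indicator_nonneg (fun _ _ => zero_le_one) _

end Drift

/-! ### The truncated density `ψ / φ`. -/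

section Tail

variable {φ ψ : ℝ → ℝ}

lemma one_le_max_mem (K u : ℝ) (hu : u ∈ Ici (1 : ℝ)) : max u K ∈ Ici (1 : ℝ) :=
  le_trans (mem_Ici.1 hu) (le_max_left _ _)

lemma antitoneOn_ratio_max (hψ : ψ ∈ G φ) (K : ℝ) :
    AntitoneOn (fun u => ψ (max u K) / φ (max u K)) (Ici 1) := fun u hu v hv huv =>
  hψ.2 (one_le_max_mem K u hu) (one_le_max_mem K v hv) (max_le_max_right K huv)

lemma monotoneOn_ite_le (hφ : IsDriftRate φ) (hψ : ψ ∈ G φ) (K : ℝ) :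
    MonotoneOn (fun v => if v ≤ K then 0 else ψ v) (Ici 1) := by
  intro u hu v hv huv
  have hv0 := hφ.nonneg_of_mem_G hψ hv
  have := hψ.1 hu hv huv
  by_cases h1 : v ≤ K
  · simp [h1, huv.trans h1]
  · by_cases h2 : u ≤ K <;> simp [h1, h2, hv0, this]

/-- The density `ψ / φ` at `K` is controlled by the mean of this density over `[1, K]`. -/
lemma ratio_le (hφ : IsDriftRate φ) (hψ : ψ ∈ G φ) {a K : ℝ} (ha : ψ 1 ≤ a) (hK : 1 ≤ K) :
    ψ K / φ K ≤ 2 * (1 + a / φ 1) * ((PhiOf φ ψ K + 1) / K) := by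
  have hφ1 := hφ.pos
  have hK0 : 0 < K := by linarith
  have ha0 : 0 ≤ a := (hφ.nonneg_of_mem_G hψ le_rfl).trans ha
  have hr0 : 0 ≤ ψ K / φ K := div_nonneg (hφ.nonneg_of_mem_G hψ hK) (hφ.pos' hK).le
  have hH0 : 0 ≤ PhiOf φ ψ K := integral_nonneg_of_nonneg_Ici
    (fun x hx => div_nonneg (hφ.nonneg_of_mem_G hψ hx) (hφ.pos' hx).le) hK
  have h1 : ψ K / φ K ≤ a / φ 1 := by
    refine (hψ.2 (mem_Ici.2 le_rfl) hK hK).trans ?_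
    simp only
    gcongr
  have h2 : ψ K / φ K * (K - 1) ≤ PhiOf φ ψ K := by
    have := integral_sub_integral_le hψ.2 le_rfl hK
    rw [intervalIntegral.integral_same] at this
    unfold PhiOf
    linarith
  have ha1 : 0 ≤ a / φ 1 := by positivity
  -- Write `K = (K - 1) + 1`: the first part is bounded by `H_ψ(K)` and the second by `a / φ(1)`.
  rw [← mul_div_assoc, le_div_iff₀ hK0]
  nlinarith [mul_nonneg ha1 hH0]

end Tail

/-! ### Ingredients of the tail bound (iii). -/

section Probability

variable {X : Type*} [MeasurableSpace X] {P : Kernel X X} [IsMarkovKernel P] {C : Set X}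
  {ε : ℝ} {ν : Measure X} {φ ψ : ℝ → ℝ} {V : X → ℝ} {b R : ℝ}

/-- Bound on the expected contribution to the excursion sum of the states where `V` exceeds `K`. -/
lemma lintegral_excursionSum_gt_le (hφ : IsDriftRate φ) (hb : 0 < b) (h : SmallSet P C ε ν)
    (hV : DriftCondition P C φ V b R) (hψ : ψ ∈ G φ) {K : ℝ} (hK : 1 ≤ K) (x : X) :
    ∫⁻ ω, excursionSum (fun k w => if V (w k).1 ≤ K then 0 else ψ (V (w k).1)) ω
        ∂(splitChain h (Measure.dirac x)) ≤
      ENNReal.ofReal (ψ K / φ K * (1 + (max R 1 - 1 + b) / ε) * V x) := by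
  have hε := h.eps_pos
  have hR : 0 ≤ max R 1 - 1 := sub_nonneg.2 (le_max_right _ _)
  -- Freezing the density `ψ / φ` at its value at `K` on `[1, K]` keeps it antitone, and its product
  -- with `φ` still dominates `ψ 1_{v > K}`. Its primitive has slope at most `ψ(K) / φ(K)`, whence a
  -- bound linear in `V`.
  have hfa := antitoneOn_ratio_max hψ K
  have hf0 : ∀ v, 1 ≤ v → 0 ≤ ψ (max v K) / φ (max v K) := fun v hv =>
    div_nonneg (hφ.nonneg_of_mem_G hψ (one_le_max_mem K v hv)) (hφ.pos' (one_le_max_mem K v hv)).le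
  refine (lintegral_excursionSum_comp_le hb h hV (g := fun v => if v ≤ K then 0 else ψ v) hfa hf0
    (measurable_comp_of_monotoneOn (monotoneOn_ite_le hφ hψ K) hV.measurable hV.one_le) ?_ ?_
    x).trans (ENNReal.ofReal_le_ofReal ?_)
  · intro v hv
    split_ifs
    · exact le_rfl
    · exact hφ.nonneg_of_mem_G hψ hv
  · intro v hv
    split_ifs with hvK
    · exact mul_nonneg (hf0 v hv) (hφ.pos' hv).le
    · rw [max_eq_left (not_le.1 hvK).le, div_mul_cancel₀ _ (hφ.pos' hv).ne']
  · have hint : ∀ v, 1 ≤ v →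
        ∫ u in (1 : ℝ)..v, ψ (max u K) / φ (max u K) ≤ ψ K / φ K * (v - 1) := fun v hv => by
      have := integral_sub_integral_le hfa hv le_rfl
      rw [intervalIntegral.integral_same, max_eq_right hK] at this
      linarith
    have h1 := hint _ (hV.one_le x)
    have h2 := hint _ (le_max_right R 1)
    have hVx := hV.one_le x
    set r := ψ K / φ K with hr
    have hr0 : 0 ≤ r := div_nonneg (hφ.nonneg_of_mem_G hψ hK) (hφ.pos' hK).le
    rw [max_eq_right hK, ← hr]
    have h3 : (∫ u in (1 : ℝ)..V x, ψ (max u K) / φ (max u K)) * Cᶜ.indicator 1 x ≤ r * V x := by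
      by_cases hx : x ∈ C
      · simp [hx]; positivity
      · simp only [mem_compl_iff, hx, not_false_eq_true, indicator_of_mem, Pi.one_apply, mul_one]
        nlinarith
    have h4 : ((∫ u in (1 : ℝ)..max R 1, ψ (max u K) / φ (max u K)) + b * r) / ε ≤
        r * ((max R 1 - 1 + b) / ε) * V x := by
      calc _ ≤ (r * (max R 1 - 1) + b * r) / ε := by gcongr
        _ = r * ((max R 1 - 1 + b) / ε) * 1 := by ring
        _ ≤ _ := by gcongr
    nlinarith

lemma measure_le_div_of_lintegral_le {Ω : Type*} [MeasurableSpace Ω] {μ : Measure Ω}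
    {f : Ω → ℝ≥0∞} (hf : Measurable f) {s t : ℝ} (ht : 0 < t)
    (h : ∫⁻ ω, f ω ∂μ ≤ ENNReal.ofReal s) :
    μ {ω | ENNReal.ofReal t ≤ f ω} ≤ ENNReal.ofReal (s / t) := by
  rw [ENNReal.ofReal_div_of_pos ht]
  refine (meas_ge_le_lintegral_div hf.aemeasurable (ENNReal.ofReal_pos.2 ht).ne'
    ENNReal.ofReal_ne_top).trans ?_
  gcongr

/-- Tail bound for the regeneration time. -/
lemma exists_measure_excursionSum_rate_le (hφ : IsDriftRate φ) (hε : 0 < ε) (hb : 0 < b) (R : ℝ) :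
    ∃ κ : ℝ, 0 < κ ∧
      ∀ {X : Type u} [MeasurableSpace X] {P : Kernel X X} [IsMarkovKernel P] {C : Set X}
        {ν : Measure X} {V : X → ℝ} (h : SmallSet P C ε ν) (_ : DriftCondition P C φ V b R)
        (x : X) (t : ℝ), 0 < t →
        splitChain h (Measure.dirac x)
            {ω | ENNReal.ofReal t ≤ excursionSum (fun k _ => rate φ k) ω} ≤
          ENNReal.ofReal (κ / t * V x) := by
  have hφ1 := hφ.pos
  obtain ⟨B, hB, hle⟩ := exists_lintegral_excursionSum_rate_le.{u} hφ hε hb R one_pos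
  refine ⟨2 / φ 1 + B, by positivity, fun {X} _ {P} _ {C} {ν} {V} h hV x t ht => ?_⟩
  have hm : Measurable (excursionSum fun k (_ : ℕ → X × Bool) => rate φ k) :=
    measurable_excursionSum (g := fun k _ => rate φ k) fun _ => measurable_const
  refine (measure_le_div_of_lintegral_le hm ht (hle h hV x)).trans (ENNReal.ofReal_le_ofReal ?_)
  rw [div_mul_eq_mul_div]
  gcongr
  have hVx := hV.one_le x
  have h1 : (1 + 1) * (V x / φ 1) * Cᶜ.indicator 1 x ≤ 2 / φ 1 * V x := by
    by_cases hx : x ∈ C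
    · simp [hx]; positivity
    · simp only [mem_compl_iff, hx, not_false_eq_true, indicator_of_mem, Pi.one_apply, mul_one]
      apply le_of_eq; ring
  nlinarith

end Probability

end SubgeometricRegeneration

end

theorem theorem1 (φ : ℝ → ℝ) (hφ : IsDriftRate φ)
    (ε b R : ℝ) (hε : 0 < ε) (hε' : ε ≤ 1) (hb : 0 < b) :
    (∀ ψ ∈ G φ, ∃ B : ℝ, 0 ≤ B ∧
      ∀ (X : Type u) [MeasurableSpace X] (P : Kernel X X) [IsMarkovKernel P] (C : Set X)
        (ν : Measure X) (V : X → ℝ) (h : SmallSet P C ε ν) (_ : DriftCondition P C φ V b R)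
        (x : X),
        ∫⁻ ω, excursionSum (fun k w => ψ (V (w k).1)) ω ∂(splitChain h (Measure.dirac x)) ≤
          ENNReal.ofReal (PhiOf φ ψ (V x) * Cᶜ.indicator 1 x + B)) ∧
    (∀ δ : ℝ, 0 < δ → ∃ B : ℝ, 0 ≤ B ∧
      ∀ (X : Type u) [MeasurableSpace X] (P : Kernel X X) [IsMarkovKernel P] (C : Set X)
        (ν : Measure X) (V : X → ℝ) (h : SmallSet P C ε ν) (_ : DriftCondition P C φ V b R)
        (x : X),
        ∫⁻ ω, excursionSum (fun k _ => rate φ k) ω ∂(splitChain h (Measure.dirac x)) ≤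
          ENNReal.ofReal ((1 + δ) * (V x / φ 1) * Cᶜ.indicator 1 x + B)) ∧
    (∀ a : ℝ, ∃ κ : ℝ, 0 < κ ∧
      ∀ (c K : ℝ), 0 < c → c < 1 → 1 ≤ K → ∀ ψ ∈ G φ, ψ 1 ≤ a →
      ∀ (X : Type u) [MeasurableSpace X] (P : Kernel X X) [IsMarkovKernel P] (C : Set X)
        (ν : Measure X) (V : X → ℝ) (h : SmallSet P C ε ν) (_ : DriftCondition P C φ V b R)
        (x : X) (M : ℝ), 0 < M →
        splitChain h (Measure.dirac x)
            {ω | ENNReal.ofReal M ≤ excursionSum (fun k w => ψ (V (w k).1)) ω} ≤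
          ENNReal.ofReal (κ * (1 / PhiInv φ (c * M / ψ K) +
            (PhiOf φ ψ K + 1) / ((1 - c) * M * K)) * V x)) := by
  have hφ1 := hφ.pos
  refine ⟨fun ψ hψ => ?_, fun δ hδ => ?_, fun a => ?_⟩
  · have hf0 : ∀ v, 1 ≤ v → 0 ≤ ψ v / φ v := fun v hv =>
      div_nonneg (hφ.nonneg_of_mem_G hψ hv) (hφ.pos' hv).le
    have hR0 : 0 ≤ PhiOf φ ψ (max R 1) := integral_nonneg_of_nonneg_Ici hf0 (le_max_right _ _)
    have h10 := hf0 1 le_rfl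
    refine ⟨(PhiOf φ ψ (max R 1) + b * (ψ 1 / φ 1)) / ε, by positivity, ?_⟩
    intro X _ P _ C ν V h hV x
    exact lintegral_excursionSum_comp_le hb h hV hψ.2 hf0
      (measurable_comp_of_monotoneOn hψ.1 hV.measurable hV.one_le)
      (fun v hv => hφ.nonneg_of_mem_G hψ hv)
      (fun v hv => (div_mul_cancel₀ _ (hφ.pos' hv).ne').ge) x
  · obtain ⟨B, hB, hle⟩ := exists_lintegral_excursionSum_rate_le.{u} hφ hε hb R hδ
    exact ⟨B, hB, fun X _ P _ C ν V h hV x => hle h hV x⟩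
  · obtain ⟨κ₁, hκ₁, hrate⟩ := exists_measure_excursionSum_rate_le.{u} hφ hε hb R
    obtain ⟨D, hD, hexc⟩ := exists_PhiInv_le_excursionSum_rate.{u} hφ
    have hR : 0 ≤ max R 1 - 1 := sub_nonneg.2 (le_max_right _ _)
    set N := 1 + (max R 1 - 1 + b) / ε with hN
    have hN1 : 1 ≤ N := by
      have : 0 ≤ (max R 1 - 1 + b) / ε := by positivity
      linarith
    have ha0 : 0 ≤ |a| / φ 1 := by positivity
    -- The summand `1` covers the case `ψ K = 0`, where `c * M / 0 = 0` and `Φ⁻¹(0) = 1` make the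
    -- bound at least `1`. The other two come from the parts `V ≤ K` and `V > K`.
    refine ⟨1 + κ₁ * D + 2 * (1 + |a| / φ 1) * N, by positivity, ?_⟩
    intro c K hc hc1 hK ψ hψ hψa X _ P _ C ν V h hV x M hM
    have hVx := hV.one_le x
    have hψK := hφ.nonneg_of_mem_G hψ hK
    have hH0 : 0 ≤ PhiOf φ ψ K := integral_nonneg_of_nonneg_Ici
      (fun v hv => div_nonneg (hφ.nonneg_of_mem_G hψ hv) (hφ.pos' hv).le) hK
    have hc1' : 0 < 1 - c := by linarith
    have hK0 : 0 < K := by linarith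
    have hp : 1 ≤ PhiInv φ (c * M / ψ K) := hφ.one_le_PhiInv (by positivity)
    have hp0 : 0 < PhiInv φ (c * M / ψ K) := by linarith
    have := h.isProbabilityMeasure_splitMeasure (Measure.dirac x)
    have : IsProbabilityMeasure (splitChain h (Measure.dirac x)) := by
      unfold splitChain; infer_instance
    rcases hψK.eq_or_lt with h0 | hpos
    · refine prob_le_one.trans ?_
      rw [ENNReal.one_le_ofReal, ← h0, div_zero, hφ.PhiInv_zero]
      have h1 : 0 ≤ (PhiOf φ ψ K + 1) / ((1 - c) * M * K) := by positivity
      have h2 : 1 ≤ 1 + κ₁ * D + 2 * (1 + |a| / φ 1) * N := by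
        have : 0 ≤ κ₁ * D := by positivity
        have : 0 ≤ 2 * (1 + |a| / φ 1) * N := by positivity
        linarith
      refine one_le_mul_of_one_le_of_one_le (one_le_mul_of_one_le_of_one_le h2 ?_) hVx
      rw [div_one]
      linarith
    · have hcM : 0 < c * M := by positivity
      have hcM' : 0 < (1 - c) * M := by positivity
      have hm : Measurable (excursionSum fun k (w : ℕ → X × Bool) =>
          if V (w k).1 ≤ K then 0 else ψ (V (w k).1)) :=
        measurable_excursionSum (g := fun _ y => if V y ≤ K then 0 else ψ (V y)) fun _ =>
          measurable_comp_of_monotoneOn (monotoneOn_ite_le hφ hψ K) hV.measurable hV.one_le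
      -- A sum of at least `M` has a part `V ≤ K` of at least `c M` or a part `V > K` of at least
      -- `(1 - c) M`.
      have hsub : {ω | ENNReal.ofReal M ≤ excursionSum (fun k w => ψ (V (w k).1)) ω} ⊆
          {ω | ENNReal.ofReal (PhiInv φ (c * M / ψ K) / D) ≤
            excursionSum (fun k (_ : ℕ → X × Bool) => rate φ k) ω} ∪
          {ω | ENNReal.ofReal ((1 - c) * M) ≤ excursionSum (fun k (w : ℕ → X × Bool) =>
            if V (w k).1 ≤ K then 0 else ψ (V (w k).1)) ω} := by
        intro ω hω
        by_contra hcon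
        simp only [mem_union, mem_ofPred_eq, not_or, not_le] at hcon hω
        have h1 : excursionSum (fun k (w : ℕ → X × Bool) =>
            if V (w k).1 ≤ K then ψ (V (w k).1) else 0) ω < ENNReal.ofReal (c * M) := by
          by_contra! hge
          refine hcon.1.not_ge (hexc ω _ (ψ K) (c * M) hpos hcM (fun k => ?_) (fun k => ?_) hge)
          · split_ifs
            · exact hφ.nonneg_of_mem_G hψ (hV.one_le _)
            · exact le_rfl
          · split_ifs with hle
            · exact hψ.1 (hV.one_le _) hK hle
            · exact hψK
        have h2 := (excursionSum_le_add (g := fun k (w : ℕ → X × Bool) => ψ (V (w k).1))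
          (g₁ := fun k (w : ℕ → X × Bool) => if V (w k).1 ≤ K then ψ (V (w k).1) else 0)
          (g₂ := fun k (w : ℕ → X × Bool) => if V (w k).1 ≤ K then 0 else ψ (V (w k).1))
          (ω := ω) fun k => by split_ifs <;> simp).trans_lt
            (ENNReal.add_lt_add h1 hcon.2)
        rw [← ENNReal.ofReal_add hcM.le hcM'.le] at h2
        refine (hω.trans_lt h2).ne ?_
        congr 1; ring
      refine ((measure_mono hsub).trans (measure_union_le _ _)).trans ?_
      refine (add_le_add (hrate h hV x _ (by positivity)) (measure_le_div_of_lintegral_le hm hcM'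
        (lintegral_excursionSum_gt_le hφ hb h hV hψ hK x))).trans ?_
      rw [← hN, ← ENNReal.ofReal_add (by positivity)
        (div_nonneg (mul_nonneg (mul_nonneg (div_nonneg hψK (hφ.pos' hK).le) (by linarith))
          (by linarith)) hcM'.le)]
      refine ENNReal.ofReal_le_ofReal ?_
      have hr := ratio_le hφ hψ (hψa.trans (le_abs_self a)) hK
      set p := PhiInv φ (c * M / ψ K) with hp_def
      set H := PhiOf φ ψ K with hH_def
      calc κ₁ / (p / D) * V x + ψ K / φ K * N * V x / ((1 - c) * M)
          ≤ κ₁ / (p / D) * V x +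
            2 * (1 + |a| / φ 1) * ((H + 1) / K) * N * V x / ((1 - c) * M) := by gcongr
        _ = (κ₁ * D * (1 / p) + 2 * (1 + |a| / φ 1) * N * ((H + 1) / ((1 - c) * M * K))) *
            V x := by field_simp
        _ ≤ _ := by
          have hk : 0 ≤ κ₁ * D := by positivity
          have hk' : 0 ≤ 2 * (1 + |a| / φ 1) * N := by positivity
          have hp1 : 0 ≤ 1 / p := by positivity
          have hq1 : 0 ≤ (H + 1) / ((1 - c) * M * K) := by positivity
          gcongr
          nlinarith [mul_nonneg hk hq1, mul_nonneg hk' hp1]
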